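/- \textbf{Setting.} Let $d\in\{1,2,3\}$ and let $(\Omega,\mathcal F,P)$ be a probability space. A complex generalized random field $f:\Omega\to\mathscr D'(\mathbb R^d)$ is centered Gaussian if $\langle f,\psi\rangle$ is a centered complex Gaussian random variable for every complex test function $\psi\in C_0^\infty(\mathbb R^d)$. Let $D\subset\mathbb R^d$ be open, convex and bounded, and let $\mu^c,\mu^r\in C_0^\infty(D)$ be nonnegative. The field $f$ is microlocally isotropic of order $-m$ in $D$, with strengths $\mu^c,\mu^r$, if there are classical symbols $\sigma^c,\sigma^r\in S^{-m}(\mathbb R^d\times\mathbb R^d)$ with principal symbols $\mu^c(x)|\xi|^{-m}$ and $\mu^r(x)|\xi|^{-m}$ such that, for all test functions $\varphi,\psi$, $$\mathbb E\big(\langle \overline f,\varphi\rangle\langle f,\psi\rangle\big)=\langle K^c,\varphi\otimes\psi\rangle,\qquad \mathbb E\big(\langle f,\varphi\rangle\langle f,\psi\rangle\big)=\langle K^r,\varphi\otimes\psi\rangle,$$ where $K^\eta(x,y)=(2\pi)^{-d}\int_{\mathbb R^d}e^{i(x-y)\cdot\xi}\sigma^\eta(x,\xi)\,d\xi$ in the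 sense of distributions, $\eta\in\{c,r\}$. \textbf{Assumption.} Let $f$ be a centered complex Gaussian random field, microlocally isotropic of order $-m$ in $D$ with strengths $\mu^c,\mu^r$, whose support is almost surely a compact subset of $D$. Let $\alpha\in(\alpha_d,1)$ and $m\in(m_{d,\alpha},d)$, where $\alpha_1=\alpha_2=\frac14$, $\alpha_3=\frac38$, and $m_{1,\alpha}=\frac32-2\alpha$, $m_{2,\alpha}=\frac52-2\alpha$, $m_{3,\alpha}=\frac{15}4-2\alpha$. For a unit vector $\hat x\in\mathbb R^d$ and $k>0$ put $$F_0(\hat x,k)=C_{k,d,\alpha}\int_D e^{-ik\hat x\cdot y}f(y)\,dy,\qquad C_{k,1,\alpha}=\frac{i\,k^{1-2\alpha}}{2\alpha},\quad C_{k,2,\alpha}=\frac{(1+i)k^{3/2-2\alpha}}{4\alpha\sqrt\pi},\quad C_{k,3,\alpha}=\frac{k^{2-2\alpha}}{4\pi\alpha},$$ where the integral is the pairing of the compactly supported distribution $f$ with the smooth function $y\mapsto e^{-ik\hat x\cdot y}$. Write $\hat\mu(\xi)=\int_{\mathbb R^d}e^{-ix\cdot\xi}\mu(x)\,dx$. \textbf{Theorem.}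 For every unit vector $\hat x\in\mathbb R^d$ and every $\tau\ge0$, the following two identities hold almost surely: $$\widehat{\mu^c}(\tau\hat x)=\lim_{K\to\infty}\frac{C^c_{d,\alpha}}{K}\int_K^{2K}k^{m+4\alpha-d-1}\,\overline{F_0(\hat x,k)}\,F_0(\hat x,k+\tau)\,dk,$$ $$\widehat{\mu^r}(\tau\hat x)=\lim_{K\to\infty}\frac{C^r_{d,\alpha}}{K}\int_K^{2K}k^{m+4\alpha-d-1}\,F_0(-\hat x,k)\,F_0(\hat x,k+\tau)\,dk,$$ where $C^c_{1,\alpha}=4\alpha^2$, $C^c_{2,\alpha}=8\pi\alpha^2$, $C^c_{3,\alpha}=16\pi^2\alpha^2$ and $C^r_{1,\alpha}=-4\alpha^2$, $C^r_{2,\alpha}=-8\pi\alpha^2 i$, $C^r_{3,\alpha}=16\pi^2\alpha^2$. -/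

import Mathlib

open MeasureTheory ProbabilityTheory Filter Topology
open scoped ComplexConjugate

namespace RandomSource

open scoped Distributions ContDiff

noncomputable section

/-- The space `ℝᵈ` with its Euclidean structure. -/
abbrev Space (d : ℕ) : Type := EuclideanSpace ℝ (Fin d)

/-- Complex-valued test functions `C₀^∞(ℝᵈ)`, with the canonical LF topology. -/
abbrev Test (d : ℕ) : Type := 𝓓((⊤ : TopologicalSpace.Opens (Space d)), ℂ)

/-- Complex distributions on `ℝᵈ`: continuous `ℂ`-linear functionals on test functions. -/
abbrev Distr (d : ℕ) : Type := Test d →L[ℂ] ℂ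

/-- The complex conjugate of a test function. -/
def conjTest {d : ℕ} (φ : Test d) : Test d where
  toFun x := conj (φ x)
  contDiff' := Complex.conjCLE.contDiff.comp φ.contDiff
  hasCompactSupport' := φ.hasCompactSupport.comp_left (map_zero _)
  tsupport_subset' := fun _ _ => trivial

/-- The product of a test function and a smooth function. -/
def mulTest {d : ℕ} (χ : Test d) (g : Space d → ℂ) (hg : ContDiff ℝ ∞ g) : Test d where
  toFun x := χ x * g x
  contDiff' := χ.contDiff.mul hg
  hasCompactSupport' := χ.hasCompactSupport.mul_right
  tsupport_subset' := fun _ _ => trivial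

/-- The support of the distribution `T` is a compact subset of `D`. -/
def CompactlySupportedIn {d : ℕ} (T : Distr d) (D : Set (Space d)) : Prop :=
  ∃ S : Set (Space d), IsCompact S ∧ S ⊆ D ∧ Distribution.IsVanishingOn T Sᶜ

/-! ### Pairing a distribution supported in a bounded set with a smooth function -/

/-- `χ` is a test function equal to `1` on a neighbourhood of the closure of `D`. -/
def IsCutoff {d : ℕ} (D : Set (Space d)) (χ : Test d) : Prop :=
  ∀ᶠ x in 𝓝ˢ (closure D), χ x = 1

theorem exists_isCutoff {d : ℕ} {D : Set (Space d)} (hD : Bornology.IsBounded D) :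
    ∃ χ : Test d, IsCutoff D χ := by
  obtain ⟨r, hr⟩ := hD.subset_closedBall (0 : Space d)
  have hr1 : closure D ⊆ Metric.closedBall 0 r := closure_minimal hr Metric.isClosed_closedBall
  let b : ContDiffBump (0 : Space d) :=
    ⟨|r| + 1, |r| + 2, by positivity, by linarith⟩
  refine ⟨⟨fun x => ((b x : ℝ) : ℂ), Complex.ofRealCLM.contDiff.comp b.contDiff,
    b.hasCompactSupport.comp_left Complex.ofReal_zero, fun _ _ => trivial⟩, ?_⟩
  have hsub : closure D ⊆ Metric.ball (0 : Space d) (|r| + 1) := fun x hx => by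
    have h := Metric.mem_closedBall.1 (hr1 hx)
    exact Metric.mem_ball.2 (by linarith [le_abs_self r])
  filter_upwards [Metric.isOpen_ball.mem_nhdsSet.2 hsub] with x hx
  have : b x = 1 := b.one_of_mem_closedBall (Metric.ball_subset_closedBall hx)
  change ((b x : ℝ) : ℂ) = 1
  rw [this, Complex.ofReal_one]

open Classical in
/-- A fixed cutoff of `D` (the value `0` is only used if `D` is unbounded). -/
def cutoff {d : ℕ} (D : Set (Space d)) : Test d :=
  if h : ∃ χ : Test d, IsCutoff D χ then h.choose else 0

theorem isCutoff_cutoff {d : ℕ} {D : Set (Space d)} (hD : Bornology.IsBounded D) :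
    IsCutoff D (cutoff D) := by
  have h := exists_isCutoff hD
  rw [cutoff, dif_pos h]
  exact h.choose_spec

/-- The pairing `∫_D g(y) T(y) dy` of a distribution `T` with compact support in the bounded set
`D` and a smooth function `g`: the value of `T` at `χ g`, where `χ` is a cutoff of `D`.
By `pairOn_eq` it does not depend on `χ`. -/
def pairOn {d : ℕ} (D : Set (Space d)) (T : Distr d) (g : Space d → ℂ) (hg : ContDiff ℝ ∞ g) : ℂ :=
  T (mulTest (cutoff D) g hg)

theorem pairOn_eq {d : ℕ} {D : Set (Space d)} (hD : Bornology.IsBounded D) {T : Distr d}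
    (hT : CompactlySupportedIn T D) (g : Space d → ℂ) (hg : ContDiff ℝ ∞ g) {χ : Test d}
    (hχ : IsCutoff D χ) : pairOn D T g hg = T (mulTest χ g hg) := by
  obtain ⟨S, -, hSD, hS⟩ := hT
  rw [pairOn, ← sub_eq_zero, ← map_sub]
  refine hS _ ?_
  intro x hx hxS
  have hxD : x ∈ closure D := subset_closure (hSD hxS)
  have h1 := (isCutoff_cutoff hD).filter_mono (nhds_le_nhdsSet hxD)
  have h2 := hχ.filter_mono (nhds_le_nhdsSet hxD)
  exact notMem_tsupport_iff_eventuallyEq.2 (by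
    filter_upwards [h1, h2] with y hy1 hy2
    change cutoff D y * g y - χ y * g y = 0
    rw [hy1, hy2, sub_self]) hx

/-! ### Symbols and pseudo-differential operators -/

/-- The symbol estimates of order `s` at all frequencies `ξ` with `‖ξ‖ ≥ r`: all the mixed
derivatives `D_x^i D_ξ^j a` are `O((1 + |ξ|)^(s - j))`, uniformly in `x`. -/
def SymbolEstimates {d : ℕ} (s r : ℝ) (a : Space d → Space d → ℂ) : Prop :=
  ∀ i j : ℕ, ∃ C : ℝ, ∀ x ξ : Space d, r ≤ ‖ξ‖ →
    ‖iteratedFDeriv ℝ i (fun y => iteratedFDeriv ℝ j (a y) ξ) x‖ ≤ C * (1 + ‖ξ‖) ^ (s - (j : ℝ))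

/-- The symbol class `S^s(ℝᵈ × ℝᵈ)`. -/
def IsSymbol {d : ℕ} (s : ℝ) (a : Space d → Space d → ℂ) : Prop :=
  ContDiff ℝ ∞ (fun z : Space d × Space d => a z.1 z.2) ∧ SymbolEstimates s 0 a

/-- `a` is a classical symbol of order `s` with principal symbol `p`: it has an asymptotic
expansion `a ∼ t₀ + t₁ + t₂ + ⋯` with `t₀ = p`, where `t_j` is smooth off `ξ = 0` and positively
homogeneous of degree `s - j` in `ξ`, and `a - ∑_{j < N} t_j` satisfies, away from `ξ = 0`,
the symbol estimates of order `s - N`. -/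
def IsClassicalSymbol {d : ℕ} (s : ℝ) (a p : Space d → Space d → ℂ) : Prop :=
  IsSymbol s a ∧ ∃ t : ℕ → Space d → Space d → ℂ,
    (∀ x ξ, ξ ≠ 0 → t 0 x ξ = p x ξ) ∧
    (∀ j, ContDiffOn ℝ ∞ (fun z : Space d × Space d => t j z.1 z.2) {z | z.2 ≠ 0}) ∧
    (∀ j x ξ, ξ ≠ 0 → ∀ c : ℝ, 0 < c →
      t j x (c • ξ) = ((c ^ (s - (j : ℝ)) : ℝ) : ℂ) * t j x ξ) ∧
    ∀ N : ℕ, SymbolEstimates (s - (N : ℝ)) 1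
      (fun x ξ => a x ξ - ∑ j ∈ Finset.range N, t j x ξ)

/-- The Fourier transform `ĝ(ξ) = ∫ e^{-i x·ξ} g(x) dx`. -/
def hat {d : ℕ} (g : Space d → ℂ) (ξ : Space d) : ℂ :=
  ∫ x, Complex.exp (-(Complex.I * ((inner ℝ x ξ : ℝ) : ℂ))) * g x

/-- The pseudo-differential operator with symbol `σ`:
`(Op(σ) ψ)(x) = (2π)^{-d} ∫ e^{i x·ξ} σ(x, ξ) ψ̂(ξ) dξ`. -/
def pseudoDiff {d : ℕ} (σ : Space d → Space d → ℂ) (ψ : Test d) (x : Space d) : ℂ :=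
  ((((2 * Real.pi) ^ d)⁻¹ : ℝ) : ℂ) *
    ∫ ξ, Complex.exp (Complex.I * ((inner ℝ x ξ : ℝ) : ℂ)) * σ x ξ * hat ψ ξ

/-- The distributional kernel of the bilinear form `B` is the oscillatory integral
`K(x, y) = (2π)^{-d} ∫ e^{i (x - y)·ξ} σ(x, ξ) dξ`, that is
`B(φ, ψ) = ⟨K, φ ⊗ ψ⟩ = ∫ φ(x) (Op(σ) ψ)(x) dx` for all test functions. -/
def HasSymbol {d : ℕ} (B : Test d → Test d → ℂ) (σ : Space d → Space d → ℂ) : Prop :=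
  ∀ φ ψ : Test d, B φ ψ = ∫ x, φ x * pseudoDiff σ ψ x

/-! ### Generalized Gaussian random fields -/

section Field

variable {Ω : Type*} [MeasurableSpace Ω]

/-- The covariance form `(𝔠_h φ)(ψ) = 𝔼(⟨h̄, φ⟩ ⟨h, ψ⟩)`, where the conjugate distribution is
`⟨h̄, φ⟩ = conj ⟨h, φ̄⟩`. -/
def covarianceForm {d : ℕ} (P : Measure Ω) (h : Ω → Distr d) (φ ψ : Test d) : ℂ :=
  ∫ w, conj (h w (conjTest φ)) * h w ψ ∂P

/-- The relation form `(𝔯_h φ)(ψ) = 𝔼(⟨h, φ⟩ ⟨h, ψ⟩)`. -/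
def relationForm {d : ℕ} (P : Measure Ω) (h : Ω → Distr d) (φ ψ : Test d) : ℂ :=
  ∫ w, h w φ * h w ψ ∂P

/-- `μ` is a nonnegative function in `C₀^∞(D)`. -/
structure IsStrength {d : ℕ} (D : Set (Space d)) (μ : Space d → ℝ) : Prop where
  smooth : ContDiff ℝ ∞ μ
  compact_support : HasCompactSupport μ
  support_subset : tsupport μ ⊆ D
  nonneg : ∀ x, 0 ≤ μ x

/-- `h` is a complex-valued centered generalized Gaussian random field that is microlocally
isotropic of order `-m` in `D`: its covariance and relation operators are classical
pseudo-differential operators of order `-m`, with principal symbols `μc(x) |ξ|^{-m}` and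
`μr(x) |ξ|^{-m}`. -/
structure IsGMIG {d : ℕ} (P : Measure Ω) (h : Ω → Distr d) (m : ℝ) (D : Set (Space d))
    (μc μr : Space d → ℝ) : Prop where
  gaussian : ∀ ψ : Test d, HasGaussianLaw (fun w => h w ψ) P
  centered : ∀ ψ : Test d, ∫ w, h w ψ ∂P = 0
  strength_c : IsStrength D μc
  strength_r : IsStrength D μr
  covariance : ∃ σ : Space d → Space d → ℂ,
    IsClassicalSymbol (-m) σ (fun x ξ => ((μc x * ‖ξ‖ ^ (-m) : ℝ) : ℂ)) ∧
    HasSymbol (covarianceForm P h) σ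
  relation : ∃ σ : Space d → Space d → ℂ,
    IsClassicalSymbol (-m) σ (fun x ξ => ((μr x * ‖ξ‖ ^ (-m) : ℝ) : ℂ)) ∧
    HasSymbol (relationForm P h) σ

/-- The lower bound `m_{d,α}` for the order (meaningful for `d = 1, 2, 3`). -/
def orderBound (d : ℕ) (α : ℝ) : ℝ :=
  if d = 1 then 3 / 2 - 2 * α else if d = 2 then 5 / 2 - 2 * α else 15 / 4 - 2 * α

/-- The lower bound `α_d` for the fractional exponent (meaningful for `d = 1, 2, 3`). -/
def alphaBound (d : ℕ) : ℝ := if d = 3 then 3 / 8 else 1 / 4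

/-- The assumption on the random source `f`. -/
structure SourceAssumption {d : ℕ} (P : Measure Ω) (f : Ω → Distr d) (α m : ℝ)
    (D : Set (Space d)) (μc μr : Space d → ℝ) : Prop where
  alpha_mem : α ∈ Set.Ioo (alphaBound d) 1
  order_mem : m ∈ Set.Ioo (orderBound d α) (d : ℝ)
  isOpen : IsOpen D
  convex : Convex ℝ D
  bounded : Bornology.IsBounded D
  gmig : IsGMIG P f m D μc μr
  supported : ∀ᵐ w ∂P, CompactlySupportedIn (f w) D

end Field

/-! ### The leading Born term of the far field -/

/-- The far-field constant `C_{k,d,α}` of the Green function (meaningful for `d = 1, 2, 3`). -/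
def farConst (d : ℕ) (α k : ℝ) : ℂ :=
  if d = 1 then Complex.I * ((k ^ (1 - 2 * α) : ℝ) : ℂ) / (2 * (α : ℂ))
  else if d = 2 then
    (1 + Complex.I) * ((k ^ (3 / 2 - 2 * α) : ℝ) : ℂ) / (4 * (α : ℂ) * ((Real.sqrt Real.pi : ℝ) : ℂ))
  else ((k ^ (2 - 2 * α) : ℝ) : ℂ) / (4 * (Real.pi : ℂ) * (α : ℂ))

/-- The plane wave `y ↦ e^{-i k θ·y}`. -/
def planeWave {d : ℕ} (θ : Space d) (k : ℝ) (y : Space d) : ℂ :=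
  Complex.exp (-(Complex.I * (((k * inner ℝ θ y) : ℝ) : ℂ)))

theorem contDiff_planeWave {d : ℕ} (θ : Space d) (k : ℝ) : ContDiff ℝ ∞ (planeWave θ k) := by
  refine Complex.contDiff_exp.comp (contDiff_const.mul ?_).neg
  exact Complex.ofRealCLM.contDiff.comp (contDiff_const.mul (contDiff_const.inner ℝ contDiff_id))

/-- The leading Born term `F₀(θ, k) = C_{k,d,α} ∫_D e^{-i k θ·y} T(y) dy` for the source `T`. -/
def born {d : ℕ} (α : ℝ) (D : Set (Space d)) (T : Distr d) (θ : Space d) (k : ℝ) : ℂ :=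
  farConst d α k * pairOn D T (planeWave θ k) (contDiff_planeWave θ k)

/-- The constant `C^c_{d,α}` (meaningful for `d = 1, 2, 3`). -/
def covConst (d : ℕ) (α : ℝ) : ℂ :=
  if d = 1 then 4 * (α : ℂ) ^ 2
  else if d = 2 then 8 * (Real.pi : ℂ) * (α : ℂ) ^ 2
  else 16 * (Real.pi : ℂ) ^ 2 * (α : ℂ) ^ 2

/-- The constant `C^r_{d,α}` (meaningful for `d = 1, 2, 3`). -/
def relConst (d : ℕ) (α : ℝ) : ℂ :=
  if d = 1 then -4 * (α : ℂ) ^ 2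
  else if d = 2 then -8 * (Real.pi : ℂ) * (α : ℂ) ^ 2 * Complex.I
  else 16 * (Real.pi : ℂ) ^ 2 * (α : ℂ) ^ 2

end

end RandomSource

open RandomSource

/-!
Write `X t` for the pairing of `f` with `e^{-i t θ·y}`. Up to the explicit far-field constants, the
two averages are those of `k ↦ r(k) conj (X k) X (k + τ)` and `k ↦ r(k) X (-k) X (k + τ)`, where
the weight `r(k)` is asymptotic to `k^m`. Both are products `U V` of two processes taken from one
complex Gaussian space, and the theorem follows by computing the expectation of the product and by
showing that its fluctuations average out (`ae_tendsto_average_mul`).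

Expectation. All the second moments of `X` are values of `modForm`, the form `∫ φ Op(σ) ψ` at
modulated cutoffs `φ = c e^{i s θ·x}`, `ψ = χ e^{-i t θ·x}`. Passing to the frequency `η` of the
cutoff, `Op(σ) ψ` samples `σ` at `η - t θ`, and `χ̂(η)` decays rapidly. Dominated convergence, the
first term of the expansion of `σ` and Fourier inversion give
`k^m modForm k (k + τ) → μ̂(τθ)` (`tendsto_modForm`).

Fluctuations. One integration by parts in the direction `θ`, together with Peetre's inequality,
bounds `modForm s t` by `(1 + |t|)^{-m} (1 + |s - t|)⁻¹` (`exists_modForm_le`). Hence the covariance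
of the field decays in the difference of the frequencies and its relation decays in their sum. By
Wick's formula (`IsGaussianSpace.wick`), the covariance of the centered products `r(k) U_k V_k` at
`k, l ∈ [K, 2K]` is a sum of two products of two such factors, so it is `O((1 + (k - l)²)⁻¹)`.
Therefore the average over `[K, 2K]` has variance `O(1 / K)`, which is summable along `K = n²`; the
contribution of the gap from `n²` to `(n + 1)²` has second moment `O(n⁻²)`, and the averages
converge almost surely (`ae_tendsto_average_zero`). The integrals over `k` require a jointly
measurable version of the field, which exists because the paths `t ↦ X t` are continuous
(`continuous_mulTest_planeWave`, `exists_stronglyMeasurable_modification`).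
-/

namespace RandomSource

open scoped Distributions ContDiff FourierTransform

/-! ### Moments of Gaussian variables -/

section Wick

/-- A complex variable whose real and imaginary parts lie in `G`. -/
def MemComplexify {Ω : Type*} (G : Submodule ℝ (Ω → ℝ)) (U : Ω → ℂ) : Prop :=
  ∃ A ∈ G, ∃ B ∈ G, U = fun w => (A w : ℂ) + Complex.I * (B w : ℂ)

theorem MemComplexify.star {Ω : Type*} {G : Submodule ℝ (Ω → ℝ)} {U : Ω → ℂ} (h : MemComplexify G U) :
    MemComplexify G (fun w => conj (U w)) := by
  obtain ⟨A, hA, B, hB, rfl⟩ := h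
  refine ⟨A, hA, -B, G.neg_mem hB, funext fun w => ?_⟩
  simp

variable {Ω : Type*} [MeasurableSpace Ω] {P : Measure Ω}

theorem integral_pow_four_gaussianReal (v : NNReal) :
    ∫ x, x ^ 4 ∂(gaussianReal 0 v) = 3 * (v : ℝ) ^ 2 := by
  have hmgf : mgf id (gaussianReal 0 v) = fun t => Real.exp (v * t ^ 2 / 2) := by
    rw [mgf_id_gaussianReal]; simp
  have h := iteratedDeriv_mgf_zero (X := id) (μ := gaussianReal 0 v) (by
    rw [integrableExpSet_id_gaussianReal]; simp) 4
  have hE (t : ℝ) : HasDerivAt (fun t : ℝ => Real.exp (v * t ^ 2 / 2))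
      (v * t * Real.exp (v * t ^ 2 / 2)) t := by
    have := ((((hasDerivAt_id t).pow 2).const_mul (v : ℝ)).div_const 2).exp
    refine this.congr_deriv ?_
    simp; ring
  have h1 : deriv (fun t : ℝ => Real.exp (v * t ^ 2 / 2)) =
      fun t => v * t * Real.exp (v * t ^ 2 / 2) := funext fun t => (hE t).deriv
  have h2 : deriv (fun t : ℝ => v * t * Real.exp (v * t ^ 2 / 2)) =
      fun t => (v + v ^ 2 * t ^ 2) * Real.exp (v * t ^ 2 / 2) := funext fun t => by
    refine ((((hasDerivAt_id t).const_mul (v : ℝ)).mul (hE t)).congr_deriv ?_).deriv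
    simp; ring
  have h3 : deriv (fun t : ℝ => (v + v ^ 2 * t ^ 2) * Real.exp (v * t ^ 2 / 2)) =
      fun t => (3 * v ^ 2 * t + v ^ 3 * t ^ 3) * Real.exp (v * t ^ 2 / 2) := funext fun t => by
    refine ((((((hasDerivAt_id t).pow 2).const_mul ((v : ℝ) ^ 2)).const_add (v : ℝ)).mul
      (hE t)).congr_deriv ?_).deriv
    simp; ring
  have h4 : deriv (fun t : ℝ => (3 * v ^ 2 * t + v ^ 3 * t ^ 3) * Real.exp (v * t ^ 2 / 2)) 0 =
      3 * (v : ℝ) ^ 2 := by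
    refine (((((hasDerivAt_id (0 : ℝ)).const_mul (3 * (v : ℝ) ^ 2)).add
      (((hasDerivAt_id (0 : ℝ)).pow 3).const_mul ((v : ℝ) ^ 3))).mul
      (hE 0)).congr_deriv ?_).deriv
    simp
  rw [hmgf, iteratedDeriv_succ, iteratedDeriv_succ, iteratedDeriv_succ, iteratedDeriv_one,
    h1, h2, h3, h4] at h
  exact h.symm

theorem integral_pow_four_of_hasGaussianLaw {X : Ω → ℝ} (hX : HasGaussianLaw X P)
    (h0 : ∫ w, X w ∂P = 0) : ∫ w, X w ^ 4 ∂P = 3 * (∫ w, X w ^ 2 ∂P) ^ 2 := by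
  have hv : Var[X; P] = ∫ w, X w ^ 2 ∂P := variance_of_integral_eq_zero hX.aemeasurable h0
  have h1 : ∫ w, X w ^ 4 ∂P = ∫ x, x ^ 4 ∂(P.map X) :=
    (integral_map (f := fun x : ℝ => x ^ 4) hX.aemeasurable (by fun_prop)).symm
  rw [h1, hX.map_eq_gaussianReal, h0, integral_pow_four_gaussianReal,
    Real.coe_toNNReal _ (variance_nonneg _ _), hv]

/-- All the moments of `U` are finite. -/
def HasMoments {E : Type*} [NormedAddCommGroup E] (P : Measure Ω) (U : Ω → E) : Prop :=
  ∀ n : ℕ, MemLp U n P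

theorem _root_.ProbabilityTheory.HasGaussianLaw.hasMoments {E : Type*} [NormedAddCommGroup E]
    [NormedSpace ℝ E] [MeasurableSpace E] [BorelSpace E] [CompleteSpace E]
    [SecondCountableTopology E] {U : Ω → E} (h : HasGaussianLaw U P) : HasMoments P U :=
  fun _ => h.memLp (by simp)

theorem HasMoments.add {E : Type*} [NormedAddCommGroup E] {U V : Ω → E} (hU : HasMoments P U)
    (hV : HasMoments P V) : HasMoments P (fun w => U w + V w) := fun n => (hU n).add (hV n)

theorem HasMoments.mul {R : Type*} [NormedRing R] {U V : Ω → R} (hU : HasMoments P U)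
    (hV : HasMoments P V) : HasMoments P (fun w => U w * V w) := fun n => by
  have : ENNReal.HolderTriple ((2 * n : ℕ) : ENNReal) ((2 * n : ℕ) : ENNReal) (n : ENNReal) := by
    constructor
    push_cast
    rw [ENNReal.mul_inv (by simp) (by simp), ← add_mul, ENNReal.inv_two_add_inv_two, one_mul]
  exact (hV (2 * n)).mul' (hU (2 * n))

theorem HasMoments.const_mul {R : Type*} [NormedRing R] {U : Ω → R} (hU : HasMoments P U)
    (c : R) : HasMoments P (fun w => c * U w) := fun n => (hU n).const_mul c

theorem HasMoments.ofReal {U : Ω → ℝ} (hU : HasMoments P U) :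
    HasMoments P (fun w => (U w : ℂ)) := fun n => (hU n).ofReal

theorem HasMoments.star {U : Ω → ℂ} (hU : HasMoments P U) :
    HasMoments P (fun w => conj (U w)) := fun n => by
  exact (hU n).star

theorem HasMoments.integrable {E : Type*} [NormedAddCommGroup E] {U : Ω → E}
    (hU : HasMoments P U) : Integrable U P := memLp_one_iff_integrable.1 (by exact_mod_cast hU 1)

/-- Wick's formula for the fourth moment of `U₁, U₂, U₃, U₄`. -/
def Wick {𝕜 : Type*} [RCLike 𝕜] (P : Measure Ω) (U₁ U₂ U₃ U₄ : Ω → 𝕜) : Prop :=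
  ∫ w, U₁ w * U₂ w * (U₃ w * U₄ w) ∂P =
    (∫ w, U₁ w * U₂ w ∂P) * (∫ w, U₃ w * U₄ w ∂P) +
    (∫ w, U₁ w * U₃ w ∂P) * (∫ w, U₂ w * U₄ w ∂P) +
    (∫ w, U₁ w * U₄ w ∂P) * (∫ w, U₂ w * U₃ w ∂P)

/-- A real vector space of centered Gaussian variables. -/
structure IsGaussianSpace (P : Measure Ω) (G : Submodule ℝ (Ω → ℝ)) : Prop where
  gaussian : ∀ X ∈ G, HasGaussianLaw X P
  centered : ∀ X ∈ G, ∫ w, X w ∂P = 0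

/-- Wick's formula in a real Gaussian space: polarize `𝔼 X⁴ = 3 (𝔼 X²)²`. -/
theorem IsGaussianSpace.wick_real {G : Submodule ℝ (Ω → ℝ)} (hG : IsGaussianSpace P G)
    {A B C D : Ω → ℝ} (hA : A ∈ G) (hB : B ∈ G) (hC : C ∈ G) (hD : D ∈ G) : Wick P A B C D := by
  have mA := (hG.gaussian A hA).hasMoments
  have mB := (hG.gaussian B hB).hasMoments
  have mC := (hG.gaussian C hC).hasMoments
  have mD := (hG.gaussian D hD).hasMoments
  have key (b c d : ℝ) : ∫ w, (A w + b * B w + c * C w + d * D w) ^ 4 ∂P =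
      3 * ((∫ w, A w * A w ∂P) + b ^ 2 * (∫ w, B w * B w ∂P) + c ^ 2 * (∫ w, C w * C w ∂P) +
        d ^ 2 * (∫ w, D w * D w ∂P) + 2 * b * (∫ w, A w * B w ∂P) + 2 * c * (∫ w, A w * C w ∂P) +
        2 * d * (∫ w, A w * D w ∂P) + 2 * b * c * (∫ w, B w * C w ∂P) +
        2 * b * d * (∫ w, B w * D w ∂P) + 2 * c * d * (∫ w, C w * D w ∂P)) ^ 2 := by
    have hmem : A + b • B + c • C + d • D ∈ G :=
      G.add_mem (G.add_mem (G.add_mem hA (G.smul_mem b hB)) (G.smul_mem c hC)) (G.smul_mem d hD)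
    have h := integral_pow_four_of_hasGaussianLaw (hG.gaussian _ hmem) (hG.centered _ hmem)
    simp only [Pi.add_apply, Pi.smul_apply, smul_eq_mul] at h
    rw [h]
    congr 2
    have e (w : Ω) : (A w + b * B w + c * C w + d * D w) ^ 2 =
        A w * A w + b ^ 2 * (B w * B w) + c ^ 2 * (C w * C w) + d ^ 2 * (D w * D w) +
        2 * b * (A w * B w) + 2 * c * (A w * C w) + 2 * d * (A w * D w) +
        2 * b * c * (B w * C w) + 2 * b * d * (B w * D w) + 2 * c * d * (C w * D w) := by ring
    simp_rw [e]
    have i1 := (mA.mul mA).integrable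
    have i2 := (mB.mul mB).integrable.const_mul (b ^ 2)
    have i3 := (mC.mul mC).integrable.const_mul (c ^ 2)
    have i4 := (mD.mul mD).integrable.const_mul (d ^ 2)
    have i5 := (mA.mul mB).integrable.const_mul (2 * b)
    have i6 := (mA.mul mC).integrable.const_mul (2 * c)
    have i7 := (mA.mul mD).integrable.const_mul (2 * d)
    have i8 := (mB.mul mC).integrable.const_mul (2 * b * c)
    have i9 := (mB.mul mD).integrable.const_mul (2 * b * d)
    have i10 := (mC.mul mD).integrable.const_mul (2 * c * d)
    rw [integral_add (by fun_prop) i10, integral_add (by fun_prop) i9,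
      integral_add (by fun_prop) i8, integral_add (by fun_prop) i7, integral_add (by fun_prop) i6,
      integral_add (by fun_prop) i5, integral_add (by fun_prop) i4, integral_add (by fun_prop) i3,
      integral_add i1 i2]
    simp only [integral_const_mul]
  have pol (w : Ω) : A w * B w * (C w * D w) = 192⁻¹ * (
      ((A w + 1 * B w + 1 * C w + 1 * D w) ^ 4 - (A w + 1 * B w + 1 * C w + (-1) * D w) ^ 4) -
      ((A w + 1 * B w + (-1) * C w + 1 * D w) ^ 4 -
        (A w + 1 * B w + (-1) * C w + (-1) * D w) ^ 4) -
      (((A w + (-1) * B w + 1 * C w + 1 * D w) ^ 4 -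
        (A w + (-1) * B w + 1 * C w + (-1) * D w) ^ 4) -
      ((A w + (-1) * B w + (-1) * C w + 1 * D w) ^ 4 -
        (A w + (-1) * B w + (-1) * C w + (-1) * D w) ^ 4))) := by ring
  have i (b c d : ℝ) : Integrable (fun w => (A w + b * B w + c * C w + d * D w) ^ 4) P := by
    have h := ((mA.add (mB.const_mul b)).add (mC.const_mul c)).add (mD.const_mul d)
    have := ((h.mul h).mul (h.mul h)).integrable
    refine this.congr (ae_of_all _ fun w => ?_)
    ring
  unfold Wick
  simp_rw [pol]
  have sub {F H : Ω → ℝ} (hF : Integrable F P) (hH : Integrable H P) :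
      Integrable (fun w => F w - H w) P := hF.sub hH
  rw [integral_const_mul, integral_sub (sub (sub (i _ _ _) (i _ _ _)) (sub (i _ _ _) (i _ _ _)))
      (sub (sub (i _ _ _) (i _ _ _)) (sub (i _ _ _) (i _ _ _))),
    integral_sub (sub (i _ _ _) (i _ _ _)) (sub (i _ _ _) (i _ _ _)),
    integral_sub (sub (i _ _ _) (i _ _ _)) (sub (i _ _ _) (i _ _ _)),
    integral_sub (i _ _ _) (i _ _ _), integral_sub (i _ _ _) (i _ _ _),
    integral_sub (i _ _ _) (i _ _ _), integral_sub (i _ _ _) (i _ _ _)]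
  simp only [key]
  ring

theorem Wick.rotate {U₁ U₂ U₃ U₄ : Ω → ℂ} (h : Wick P U₁ U₂ U₃ U₄) : Wick P U₂ U₃ U₄ U₁ := by
  unfold Wick at *
  have e1 : ∫ w, U₂ w * U₃ w * (U₄ w * U₁ w) ∂P = ∫ w, U₁ w * U₂ w * (U₃ w * U₄ w) ∂P :=
    integral_congr_ae (ae_of_all _ fun w => by ring)
  have c (U V : Ω → ℂ) : ∫ w, U w * V w ∂P = ∫ w, V w * U w ∂P :=
    integral_congr_ae (ae_of_all _ fun w => by ring)
  rw [e1, h, c U₄ U₁, c U₃ U₁, c U₂ U₁]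
  ring

theorem Wick.add_I_mul {A B U₂ U₃ U₄ : Ω → ℂ} (mA : HasMoments P A) (mB : HasMoments P B)
    (m₂ : HasMoments P U₂) (m₃ : HasMoments P U₃) (m₄ : HasMoments P U₄)
    (hA : Wick P A U₂ U₃ U₄) (hB : Wick P B U₂ U₃ U₄) :
    Wick P (fun w => A w + Complex.I * B w) U₂ U₃ U₄ := by
  have two {V : Ω → ℂ} (mV : HasMoments P V) : ∫ w, (A w + Complex.I * B w) * V w ∂P =
      (∫ w, A w * V w ∂P) + Complex.I * ∫ w, B w * V w ∂P := by
    rw [← integral_const_mul, ← integral_add (mA.mul mV).integrable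
      ((mB.mul mV).integrable.const_mul _)]
    exact integral_congr_ae (ae_of_all _ fun w => by ring)
  have four : ∫ w, (A w + Complex.I * B w) * U₂ w * (U₃ w * U₄ w) ∂P =
      (∫ w, A w * U₂ w * (U₃ w * U₄ w) ∂P) +
        Complex.I * ∫ w, B w * U₂ w * (U₃ w * U₄ w) ∂P := by
    rw [← integral_const_mul, ← integral_add ((mA.mul m₂).mul (m₃.mul m₄)).integrable
      (((mB.mul m₂).mul (m₃.mul m₄)).integrable.const_mul _)]
    exact integral_congr_ae (ae_of_all _ fun w => by ring)
  unfold Wick at *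
  rw [four, two m₂, two m₃, two m₄]
  linear_combination hA + Complex.I * hB

theorem MemComplexify.hasMoments {G : Submodule ℝ (Ω → ℝ)} (hG : IsGaussianSpace P G) {U : Ω → ℂ}
    (h : MemComplexify G U) : HasMoments P U := by
  obtain ⟨A, hA, B, hB, rfl⟩ := h
  exact (hG.gaussian A hA).hasMoments.ofReal.add ((hG.gaussian B hB).hasMoments.ofReal.const_mul _)

theorem IsGaussianSpace.wick {G : Submodule ℝ (Ω → ℝ)} (hG : IsGaussianSpace P G)
    {U₁ U₂ U₃ U₄ : Ω → ℂ} (h₁ : MemComplexify G U₁) (h₂ : MemComplexify G U₂)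
    (h₃ : MemComplexify G U₃) (h₄ : MemComplexify G U₄) : Wick P U₁ U₂ U₃ U₄ := by
  have m₁ := h₁.hasMoments hG
  have m₂ := h₂.hasMoments hG
  have m₃ := h₃.hasMoments hG
  have m {A : Ω → ℝ} (hA : A ∈ G) : HasMoments P (fun w => (A w : ℂ)) :=
    (hG.gaussian A hA).hasMoments.ofReal
  have r {A B C D : Ω → ℝ} (hA : A ∈ G) (hB : B ∈ G) (hC : C ∈ G) (hD : D ∈ G) :
      Wick P (fun w => (A w : ℂ)) (fun w => (B w : ℂ)) (fun w => (C w : ℂ))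
        (fun w => (D w : ℂ)) := by
    have h := hG.wick_real hA hB hC hD
    unfold Wick at *
    simp only [← Complex.ofReal_mul, integral_complex_ofReal]
    exact_mod_cast h
  -- The formula is extended from real to complex variables in one slot at a time.
  have s1 {B C D : Ω → ℝ} (hB : B ∈ G) (hC : C ∈ G) (hD : D ∈ G) :
      Wick P (fun w => (B w : ℂ)) (fun w => (C w : ℂ)) (fun w => (D w : ℂ)) U₁ := by
    obtain ⟨A, hA, A', hA', rfl⟩ := h₁
    exact (Wick.add_I_mul (m hA) (m hA') (m hB) (m hC) (m hD) (r hA hB hC hD)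
      (r hA' hB hC hD)).rotate
  have s2 {C D : Ω → ℝ} (hC : C ∈ G) (hD : D ∈ G) :
      Wick P (fun w => (C w : ℂ)) (fun w => (D w : ℂ)) U₁ U₂ := by
    obtain ⟨A, hA, A', hA', rfl⟩ := h₂
    exact (Wick.add_I_mul (m hA) (m hA') (m hC) (m hD) m₁ (s1 hA hC hD) (s1 hA' hC hD)).rotate
  have s3 {D : Ω → ℝ} (hD : D ∈ G) : Wick P (fun w => (D w : ℂ)) U₁ U₂ U₃ := by
    obtain ⟨A, hA, A', hA', rfl⟩ := h₃
    exact (Wick.add_I_mul (m hA) (m hA') (m hD) m₁ m₂ (s2 hA hD) (s2 hA' hD)).rotate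
  obtain ⟨A, hA, A', hA', rfl⟩ := h₄
  exact (Wick.add_I_mul (m hA) (m hA') m₁ m₂ m₃ (s3 hA) (s3 hA')).rotate

end Wick

/-! ### An ergodic theorem for decorrelating processes -/

section Ergodic

variable {Ω : Type*} [MeasurableSpace Ω] {P : Measure Ω}

/-- A process with continuous paths agrees, off a single null set, with a jointly measurable one:
modify it on the null set where it differs at a rational time from a measurable version. -/
theorem exists_stronglyMeasurable_modification {X : ℝ → Ω → ℂ} (hc : ∀ w, Continuous fun t => X t w)
    (hm : ∀ t, AEMeasurable (X t) P) :
    ∃ X' : ℝ → Ω → ℂ, StronglyMeasurable (Function.uncurry X') ∧ (∀ᵐ w ∂P, ∀ t, X' t w = X t w) := by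
  classical
  have h0 : ∀ᵐ w ∂P, ∀ q : ℚ, X q w = (hm q).mk (X q) w := ae_all_iff.2 fun q => (hm q).ae_eq_mk
  obtain ⟨N, hN, hNm, hN0⟩ := exists_measurable_superset_of_null (ae_iff.1 h0)
  have hX (q : ℚ) (w : Ω) (hw : w ∉ N) : X q w = (hm q).mk (X q) w := by
    by_contra h
    exact hw (hN fun h' => h (h' q))
  refine ⟨fun t => Nᶜ.indicator (X t), ?_, ?_⟩
  · refine stronglyMeasurable_uncurry_of_continuous_of_stronglyMeasurable (fun w => ?_) fun t => ?_
    · by_cases hw : w ∈ N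
      · simpa [Set.indicator, hw] using continuous_const
      · simpa [Set.indicator, hw] using hc w
    · obtain ⟨q, hq⟩ : ∃ q : ℕ → ℚ, Tendsto (fun n => (q n : ℝ)) atTop (𝓝 t) := by
        have ht : t ∈ closure (Set.range ((↑) : ℚ → ℝ)) := Rat.denseRange_cast t
        obtain ⟨u, hu, hut⟩ := mem_closure_iff_seq_limit.1 ht
        choose q hq using hu
        exact ⟨q, by simpa [hq] using hut⟩
      refine Measurable.stronglyMeasurable (measurable_of_tendsto_metrizable
        (f := fun n => Nᶜ.indicator (X (q n))) (fun n => ?_) ?_)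
      · have : Nᶜ.indicator (X (q n)) = Nᶜ.indicator ((hm (q n)).mk (X (q n))) :=
          Set.indicator_congr fun w hw => hX (q n) w hw
        rw [this]
        exact (hm (q n)).measurable_mk.indicator hNm.compl
      · refine tendsto_pi_nhds.2 fun w => ?_
        by_cases hw : w ∈ N
        · simp [Set.indicator, hw]
        · simpa [Set.indicator, hw, Function.comp_def] using ((hc w).tendsto t).comp hq
  · have : ∀ᵐ w ∂P, w ∉ N := measure_eq_zero_iff_ae_notMem.1 hN0
    filter_upwards [this] with w hw t
    simp [Set.indicator, hw]

/-- The second moment of a time integral is at most the double integral of a bound for the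
correlations. -/
theorem integral_norm_sq_integral_le {T : Type*} [MeasurableSpace T] {ν : Measure T}
    [IsFiniteMeasure ν] [IsProbabilityMeasure P] {W : T → Ω → ℂ}
    (hW : StronglyMeasurable (Function.uncurry W)) {M : ℝ}
    (hb : ∀ᵐ t ∂ν, Integrable (fun w => ‖W t w‖ ^ 2) P ∧ ∫ w, ‖W t w‖ ^ 2 ∂P ≤ M)
    {g : T × T → ℝ} (hg : Integrable g (ν.prod ν))
    (hWg : ∀ᵐ z ∂ν.prod ν, ‖∫ w, W z.1 w * conj (W z.2 w) ∂P‖ ≤ g z) :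
    Integrable (fun w => ‖∫ t, W t w ∂ν‖ ^ 2) P ∧
      ∫ w, ‖∫ t, W t w ∂ν‖ ^ 2 ∂P ≤ ∫ z, g z ∂(ν.prod ν) := by
  set F : Ω × (T × T) → ℂ := fun p => W p.2.1 p.1 * conj (W p.2.2 p.1) with hFdef
  have hFm : StronglyMeasurable F := by
    have h1 : StronglyMeasurable fun p : Ω × (T × T) => W p.2.1 p.1 :=
      hW.comp_measurable (g := fun p : Ω × (T × T) => (p.2.1, p.1)) (by fun_prop)
    have h2 : StronglyMeasurable fun p : Ω × (T × T) => W p.2.2 p.1 :=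
      hW.comp_measurable (g := fun p : Ω × (T × T) => (p.2.2, p.1)) (by fun_prop)
    exact h1.mul (Complex.continuous_conj.comp_stronglyMeasurable h2)
  have hb1 := Measure.quasiMeasurePreserving_fst (μ := ν) (ν := ν) |>.ae hb
  have hb2 := Measure.quasiMeasurePreserving_snd (μ := ν) (ν := ν) |>.ae hb
  have hle (z : T × T) (w : Ω) : ‖F (w, z)‖ ≤ (‖W z.1 w‖ ^ 2 + ‖W z.2 w‖ ^ 2) / 2 := by
    simp only [hFdef, norm_mul, RCLike.norm_conj]
    nlinarith [sq_nonneg (‖W z.1 w‖ - ‖W z.2 w‖)]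
  have hFz (z : T × T) : AEStronglyMeasurable (fun w => F (w, z)) P :=
    (hFm.comp_measurable (g := fun w => (w, z)) (by fun_prop)).aestronglyMeasurable
  have hFi : Integrable F (P.prod (ν.prod ν)) := by
    rw [integrable_prod_iff' hFm.aestronglyMeasurable]
    constructor
    · filter_upwards [hb1, hb2] with z h1 h2
      exact ((h1.1.add h2.1).div_const 2).mono' (hFz z) (ae_of_all _ (hle z))
    · refine Integrable.mono' (integrable_const M) ?_ ?_
      · exact (hFm.norm.integral_prod_left' (μ := P)).aestronglyMeasurable
      · filter_upwards [hb1, hb2] with z h1 h2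
        rw [Real.norm_of_nonneg (integral_nonneg fun _ => norm_nonneg _)]
        have hi : Integrable (fun w => (‖W z.1 w‖ ^ 2 + ‖W z.2 w‖ ^ 2) / 2) P :=
          (h1.1.add h2.1).div_const 2
        calc ∫ w, ‖F (w, z)‖ ∂P ≤ ∫ w, (‖W z.1 w‖ ^ 2 + ‖W z.2 w‖ ^ 2) / 2 ∂P :=
              integral_mono (hi.mono' (hFz z) (ae_of_all _ (hle z))).norm hi (hle z)
          _ = ((∫ w, ‖W z.1 w‖ ^ 2 ∂P) + ∫ w, ‖W z.2 w‖ ^ 2 ∂P) / 2 := by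
              rw [integral_div, integral_add h1.1 h2.1]
          _ ≤ M := by linarith [h1.2, h2.2]
  have hI (w : Ω) : ∫ z, F (w, z) ∂(ν.prod ν) = ((‖∫ t, W t w ∂ν‖ ^ 2 : ℝ) : ℂ) := by
    rw [integral_prod_mul (fun t => W t w) (fun t => conj (W t w)), integral_conj,
      Complex.mul_conj, Complex.normSq_eq_norm_sq]
  have hL := hFi.integral_prod_left
  simp_rw [hI] at hL
  have hL' : Integrable (fun w => ‖∫ t, W t w ∂ν‖ ^ 2) P := hL.re
  refine ⟨hL', ?_⟩
  have h1 : ((∫ w, ‖∫ t, W t w ∂ν‖ ^ 2 ∂P : ℝ) : ℂ) =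
      ∫ z, ∫ w, F (w, z) ∂P ∂(ν.prod ν) := by
    rw [← integral_complex_ofReal]
    simp_rw [← hI]
    exact integral_integral_swap (f := fun w z => F (w, z)) hFi
  have h2 : ‖((∫ w, ‖∫ t, W t w ∂ν‖ ^ 2 ∂P : ℝ) : ℂ)‖ ≤ ∫ z, g z ∂(ν.prod ν) := by
    rw [h1]
    exact norm_integral_le_of_norm_le hg hWg
  rw [Complex.norm_real] at h2
  exact (le_abs_self _).trans h2

/-- Nonnegative variables whose expectations are summable tend to zero almost surely. -/
theorem ae_tendsto_zero_of_summable_integral {Y : ℕ → Ω → ℝ} (h0 : ∀ n w, 0 ≤ Y n w)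
    (hi : ∀ n, Integrable (Y n) P) {c : ℕ → ℝ} (hc : Summable c) (hY : ∀ n, ∫ w, Y n w ∂P ≤ c n) :
    ∀ᵐ w ∂P, Tendsto (fun n => Y n w) atTop (𝓝 0) := by
  have h1 : ∫⁻ w, ∑' n, ENNReal.ofReal (Y n w) ∂P ≠ ⊤ := by
    rw [lintegral_tsum fun n => (hi n).aemeasurable.ennreal_ofReal]
    have (n : ℕ) : ∫⁻ w, ENNReal.ofReal (Y n w) ∂P ≤ ENNReal.ofReal (c n) := by
      rw [← ofReal_integral_eq_lintegral_ofReal (hi n) (ae_of_all _ (h0 n))]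
      exact ENNReal.ofReal_le_ofReal (hY n)
    exact ((ENNReal.tsum_le_tsum this).trans_lt (hc.tsum_ofReal_lt_top)).ne
  have hm : AEMeasurable (fun w => ∑' n, ENNReal.ofReal (Y n w)) P :=
    AEMeasurable.tsum fun n => (hi n).aemeasurable.ennreal_ofReal
  filter_upwards [ae_lt_top' hm h1] with w hw
  have := ENNReal.tendsto_atTop_zero_of_tsum_ne_top hw.ne
  have := (ENNReal.tendsto_toReal ENNReal.zero_ne_top).comp this
  simpa [Function.comp_def, ENNReal.toReal_ofReal (h0 _ w)] using this

theorem ae_tendsto_zero_of_summable_sq {E : Type*} [NormedAddCommGroup E] {Y : ℕ → Ω → E}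
    (hi : ∀ n, Integrable (fun w => ‖Y n w‖ ^ 2) P) {c : ℕ → ℝ} (hc : Summable c)
    (hY : ∀ n, ∫ w, ‖Y n w‖ ^ 2 ∂P ≤ c n) : ∀ᵐ w ∂P, Tendsto (fun n => Y n w) atTop (𝓝 0) := by
  filter_upwards [ae_tendsto_zero_of_summable_integral (fun n w => sq_nonneg _) hi hc hY] with w hw
  refine tendsto_zero_iff_norm_tendsto_zero.2 ?_
  have := hw.sqrt
  simpa [Real.sqrt_sq (norm_nonneg _)] using this

theorem integral_prod_Ioc_inv_one_add_sq_le {a b M : ℝ} (hab : a ≤ b) (hM : 0 ≤ M) :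
    Integrable (fun z : ℝ × ℝ => M * (1 + (z.1 - z.2) ^ 2)⁻¹)
      ((volume.restrict (Set.Ioc a b)).prod (volume.restrict (Set.Ioc a b))) ∧
    ∫ z, M * (1 + (z.1 - z.2) ^ 2)⁻¹
      ∂((volume.restrict (Set.Ioc a b)).prod (volume.restrict (Set.Ioc a b))) ≤
        M * Real.pi * (b - a) := by
  have hcont : Continuous fun z : ℝ × ℝ => M * (1 + (z.1 - z.2) ^ 2)⁻¹ := by
    refine continuous_const.mul (Continuous.inv₀ (by fun_prop) fun z => ?_)
    positivity
  have hi : Integrable (fun z : ℝ × ℝ => M * (1 + (z.1 - z.2) ^ 2)⁻¹)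
      ((volume.restrict (Set.Ioc a b)).prod (volume.restrict (Set.Ioc a b))) := by
    refine Integrable.mono' (integrable_const M) hcont.aestronglyMeasurable
      (ae_of_all _ fun z => ?_)
    rw [Real.norm_of_nonneg (by positivity)]
    exact mul_le_of_le_one_right hM (inv_le_one_of_one_le₀ (by nlinarith [sq_nonneg (z.1 - z.2)]))
  refine ⟨hi, ?_⟩
  rw [integral_prod _ hi]
  have hin (x : ℝ) : ∫ y, M * (1 + (x - y) ^ 2)⁻¹ ∂(volume.restrict (Set.Ioc a b)) ≤
      M * Real.pi := by
    rw [integral_const_mul]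
    refine mul_le_mul_of_nonneg_left ?_ hM
    rw [← integral_univ_inv_one_add_sq,
      ← integral_sub_left_eq_self (fun y : ℝ => (1 + y ^ 2)⁻¹) volume x]
    exact setIntegral_le_integral (integrable_inv_one_add_sq.comp_sub_left x)
      (ae_of_all _ fun y => by simp only [Pi.zero_apply]; positivity)
  calc ∫ x, ∫ y, M * (1 + (x - y) ^ 2)⁻¹ ∂(volume.restrict (Set.Ioc a b))
        ∂(volume.restrict (Set.Ioc a b))
      ≤ ∫ x, M * Real.pi ∂(volume.restrict (Set.Ioc a b)) :=
        integral_mono hi.integral_prod_left (integrable_const _) hin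
    _ = M * Real.pi * (b - a) := by
        simp [hab, mul_comm]

/-- The averages over `[K, 2K]` tend to zero once they do so along `K = n²` and the contributions
of the gaps between consecutive squares are negligible. -/
theorem tendsto_average_of_squares {z : ℝ → ℂ}
    (hz : ∀ a b : ℝ, 1 ≤ a → a ≤ b → IntervalIntegrable z volume a b)
    (h1 : Tendsto (fun n : ℕ => (((n : ℝ) + 1) ^ 2)⁻¹ * ‖∫ k in Set.Ioc (((n : ℝ) + 1) ^ 2)
      (2 * ((n : ℝ) + 1) ^ 2), z k‖) atTop (𝓝 0))
    (h2 : Tendsto (fun n : ℕ => (((n : ℝ) + 1) ^ 2)⁻¹ * ∫ k in Set.Ioc (((n : ℝ) + 1) ^ 2)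
      (((n : ℝ) + 2) ^ 2), ‖z k‖) atTop (𝓝 0))
    (h3 : Tendsto (fun n : ℕ => (((n : ℝ) + 1) ^ 2)⁻¹ * ∫ k in Set.Ioc (2 * ((n : ℝ) + 1) ^ 2)
      (2 * ((n : ℝ) + 2) ^ 2), ‖z k‖) atTop (𝓝 0)) :
    Tendsto (fun K : ℝ => ((K : ℂ))⁻¹ * ∫ k in K..(2 * K), z k) atTop (𝓝 0) := by
  have hfl : Tendsto (fun K : ℝ => ⌊Real.sqrt K - 1⌋₊) atTop atTop :=
    tendsto_nat_floor_atTop.comp (tendsto_atTop_add_const_right _ _ Real.tendsto_sqrt_atTop)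
  have hsum := ((h1.add (h2.add h3)).comp hfl)
  simp only [add_zero] at hsum
  refine squeeze_zero_norm' ?_ hsum
  filter_upwards [eventually_ge_atTop 1] with K hK
  have hs1 : 1 ≤ Real.sqrt K := Real.one_le_sqrt.2 hK
  set n := ⌊Real.sqrt K - 1⌋₊ with hn
  have hn1 : (n : ℝ) ≤ Real.sqrt K - 1 := Nat.floor_le (by linarith)
  have hn2 : Real.sqrt K - 1 < n + 1 := Nat.lt_floor_add_one _
  have hsq : Real.sqrt K ^ 2 = K := Real.sq_sqrt (by linarith)
  have hn0 : (0 : ℝ) ≤ n := Nat.cast_nonneg n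
  set a : ℝ := ((n : ℝ) + 1) ^ 2 with ha
  set b : ℝ := ((n : ℝ) + 2) ^ 2 with hb
  have haK : a ≤ K := by rw [ha, ← hsq]; gcongr; linarith
  have hKb : K ≤ b := by rw [hb, ← hsq]; gcongr; linarith
  have ha1 : 1 ≤ a := by nlinarith
  have e : ∫ k in K..(2 * K), z k =
      (∫ k in a..(2 * a), z k) - (∫ k in a..K, z k) + ∫ k in (2 * a)..(2 * K), z k := by
    have e1 := intervalIntegral.integral_add_adjacent_intervals (hz a K ha1 haK)
      (hz K (2 * K) hK (by linarith))
    have e2 := intervalIntegral.integral_add_adjacent_intervals (hz a (2 * a) ha1 (by linarith))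
      (hz (2 * a) (2 * K) (by linarith) (by linarith))
    linear_combination e1 - e2
  have gap {u v v' : ℝ} (hu : 1 ≤ u) (huv : u ≤ v) (hv : v ≤ v') :
      ‖∫ k in u..v, z k‖ ≤ ∫ k in Set.Ioc u v', ‖z k‖ := by
    refine (intervalIntegral.norm_integral_le_integral_norm huv).trans ?_
    rw [intervalIntegral.integral_of_le huv]
    exact setIntegral_mono_set ((intervalIntegrable_iff_integrableOn_Ioc_of_le
      (huv.trans hv)).1 (hz u v' hu (huv.trans hv))).norm (ae_of_all _ fun _ => norm_nonneg _)
      (Set.Ioc_subset_Ioc_right hv).eventuallyLE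
  have g1 := gap ha1 haK hKb
  have g2 := gap (u := 2 * a) (v := 2 * K) (v' := 2 * b) (by linarith) (by linarith) (by linarith)
  have g0 : ‖∫ k in a..(2 * a), z k‖ = ‖∫ k in Set.Ioc a (2 * a), z k‖ := by
    rw [intervalIntegral.integral_of_le (by linarith)]
  simp only [Function.comp_apply, ← hn]
  change _ ≤ a⁻¹ * _ + (a⁻¹ * _ + a⁻¹ * _)
  rw [norm_mul, norm_inv, Complex.norm_real, Real.norm_of_nonneg (by linarith), ← mul_add,
    ← mul_add]
  refine mul_le_mul (inv_anti₀ (by linarith) haK) ?_ (norm_nonneg _) (by positivity)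
  rw [e, ← g0]
  refine (norm_add_le _ _).trans ?_
  have := norm_sub_le (∫ k in a..(2 * a), z k) (∫ k in a..K, z k)
  linarith

/-- A process whose correlations at `k, l ∈ [K, 2K]` are `O((1 + (k - l)²)⁻¹)` uniformly in `K`
has averages over `[K, 2K]` tending to zero almost surely. -/
theorem ae_tendsto_average_zero [IsProbabilityMeasure P] {Z : ℝ → Ω → ℂ}
    (hZ : StronglyMeasurable (Function.uncurry Z))
    (hint : ∀ᵐ w ∂P, ∀ a b : ℝ, 1 ≤ a → a ≤ b → IntervalIntegrable (fun k => Z k w) volume a b)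
    (hL2 : ∀ k, 1 ≤ k → Integrable (fun w => ‖Z k w‖ ^ 2) P) {M : ℝ}
    (hM : ∀ k l : ℝ, 1 ≤ k → 1 ≤ l → k ≤ 2 * l → l ≤ 2 * k →
      ‖∫ w, Z k w * conj (Z l w) ∂P‖ ≤ M * (1 + (k - l) ^ 2)⁻¹) :
    ∀ᵐ w ∂P, Tendsto (fun K : ℝ => ((K : ℂ))⁻¹ * ∫ k in K..(2 * K), Z k w) atTop (𝓝 0) := by
  have hvar (k : ℝ) (hk : 1 ≤ k) : ∫ w, ‖Z k w‖ ^ 2 ∂P ≤ M := by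
    have h := hM k k hk hk (by linarith) (by linarith)
    have e : ∫ w, Z k w * conj (Z k w) ∂P = ((∫ w, ‖Z k w‖ ^ 2 ∂P : ℝ) : ℂ) := by
      rw [← integral_complex_ofReal]
      refine integral_congr_ae (ae_of_all _ fun w => ?_)
      simp only [Complex.mul_conj, Complex.normSq_eq_norm_sq]
    rw [e, Complex.norm_real] at h
    simpa using (le_abs_self _).trans h
  have hM0 : 0 ≤ M := (integral_nonneg fun _ => sq_nonneg _).trans (hvar 1 le_rfl)
  have hmem (a b : ℝ) (ha : 1 ≤ a) : ∀ᵐ t ∂(volume.restrict (Set.Ioc a b)), 1 ≤ t :=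
    (ae_restrict_mem measurableSet_Ioc).mono fun t ht => ha.trans ht.1.le
  have hsm : Summable fun n : ℕ => (((n : ℝ) + 1) ^ 2)⁻¹ := by
    have := (summable_nat_add_iff 1).2 (Real.summable_nat_pow_inv.2 (one_lt_two))
    simpa using this
  -- The averages along the squares.
  have A : ∀ᵐ w ∂P, Tendsto (fun n : ℕ => (((n : ℝ) + 1) ^ 2)⁻¹ •
      ∫ k in Set.Ioc (((n : ℝ) + 1) ^ 2) (2 * ((n : ℝ) + 1) ^ 2), Z k w) atTop (𝓝 0) := by
    have key (n : ℕ) := by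
      have hn : (1 : ℝ) ≤ ((n : ℝ) + 1) ^ 2 := by nlinarith [(Nat.cast_nonneg n : (0 : ℝ) ≤ n)]
      have hJ := integral_prod_Ioc_inv_one_add_sq_le (a := ((n : ℝ) + 1) ^ 2)
        (b := 2 * ((n : ℝ) + 1) ^ 2) (by linarith) hM0
      refine And.intro hJ.2 (integral_norm_sq_integral_le (P := P) hZ (M := M)
        ((hmem _ _ hn).mono fun t ht => ⟨hL2 t ht, hvar t ht⟩) hJ.1 ?_)
      rw [Measure.prod_restrict]
      filter_upwards [ae_restrict_mem (measurableSet_Ioc.prod measurableSet_Ioc)] with z hz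
      obtain ⟨⟨h1, h2⟩, h3, h4⟩ := hz
      exact hM _ _ (by linarith) (by linarith) (by linarith) (by linarith)
    refine ae_tendsto_zero_of_summable_sq (c := fun n => M * Real.pi * (((n : ℝ) + 1) ^ 2)⁻¹)
      (fun n => ?_) (hsm.mul_left _) fun n => ?_
    · simp_rw [norm_smul, mul_pow]
      exact (key n).2.1.const_mul _
    · simp_rw [norm_smul, mul_pow]
      rw [integral_const_mul]
      have hp : (0 : ℝ) < ((n : ℝ) + 1) ^ 2 := by positivity
      rw [Real.norm_of_nonneg (by positivity)]
      calc _ ≤ ((((n : ℝ) + 1) ^ 2)⁻¹) ^ 2 *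
            (M * Real.pi * (2 * ((n : ℝ) + 1) ^ 2 - ((n : ℝ) + 1) ^ 2)) := by
            gcongr
            exact (key n).2.2.trans (key n).1
        _ = _ := by field_simp; ring
  -- The contributions of the gaps between consecutive squares.
  have B (s : ℝ) (hs : 1 ≤ s) : ∀ᵐ w ∂P, Tendsto (fun n : ℕ => (((n : ℝ) + 1) ^ 2)⁻¹ •
      ∫ k in Set.Ioc (s * ((n : ℝ) + 1) ^ 2) (s * ((n : ℝ) + 2) ^ 2), ((‖Z k w‖ : ℝ) : ℂ))
      atTop (𝓝 0) := by
    have hZn : StronglyMeasurable (Function.uncurry fun k w => ((‖Z k w‖ : ℝ) : ℂ)) :=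
      Complex.continuous_ofReal.comp_stronglyMeasurable hZ.norm
    have key (n : ℕ) := by
      have hn : (1 : ℝ) ≤ s * ((n : ℝ) + 1) ^ 2 := by
        have : (1 : ℝ) ≤ ((n : ℝ) + 1) ^ 2 := by nlinarith [(Nat.cast_nonneg n : (0 : ℝ) ≤ n)]
        nlinarith
      refine integral_norm_sq_integral_le (P := P) hZn (M := M) (g := fun _ => M)
        (ν := volume.restrict (Set.Ioc (s * ((n : ℝ) + 1) ^ 2) (s * ((n : ℝ) + 2) ^ 2)))
        ((hmem _ _ hn).mono fun t ht => ⟨by simpa using hL2 t ht, by simpa using hvar t ht⟩)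
        (integrable_const _) ?_
      rw [Measure.prod_restrict]
      filter_upwards [ae_restrict_mem (measurableSet_Ioc.prod measurableSet_Ioc)] with z hz
      obtain ⟨⟨h1, h2⟩, h3, h4⟩ := hz
      have i1 := hL2 z.1 (by linarith)
      have i2 := hL2 z.2 (by linarith)
      calc _ ≤ ∫ w, (‖Z z.1 w‖ ^ 2 + ‖Z z.2 w‖ ^ 2) / 2 ∂P := by
            refine norm_integral_le_of_norm_le ((i1.add i2).div_const 2) (ae_of_all _ fun w => ?_)
            simp only [Complex.conj_ofReal, norm_mul, Complex.norm_real, norm_norm]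
            nlinarith [sq_nonneg (‖Z z.1 w‖ - ‖Z z.2 w‖)]
        _ = ((∫ w, ‖Z z.1 w‖ ^ 2 ∂P) + ∫ w, ‖Z z.2 w‖ ^ 2 ∂P) / 2 := by
            rw [integral_div, integral_add i1 i2]
        _ ≤ M := by linarith [hvar z.1 (by linarith), hvar z.2 (by linarith)]
    refine ae_tendsto_zero_of_summable_sq
      (c := fun n => M * 9 * s ^ 2 * (((n : ℝ) + 1) ^ 2)⁻¹)
      (fun n => ?_) (hsm.mul_left _) fun n => ?_
    · simp_rw [norm_smul, mul_pow]
      exact (key n).1.const_mul _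
    · simp_rw [norm_smul, mul_pow]
      rw [integral_const_mul]
      have hn0 : (0 : ℝ) ≤ n := Nat.cast_nonneg n
      have hp : (0 : ℝ) < ((n : ℝ) + 1) ^ 2 := by positivity
      rw [Real.norm_of_nonneg (by positivity)]
      have hlen : s * ((n : ℝ) + 2) ^ 2 - s * ((n : ℝ) + 1) ^ 2 ≤ 3 * s * ((n : ℝ) + 1) := by
        nlinarith
      have hlen0 : 0 ≤ s * ((n : ℝ) + 2) ^ 2 - s * ((n : ℝ) + 1) ^ 2 := by
        nlinarith
      have hv : ∫ z, M ∂((volume.restrict (Set.Ioc (s * ((n : ℝ) + 1) ^ 2)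
          (s * ((n : ℝ) + 2) ^ 2))).prod (volume.restrict (Set.Ioc (s * ((n : ℝ) + 1) ^ 2)
          (s * ((n : ℝ) + 2) ^ 2)))) =
          (s * ((n : ℝ) + 2) ^ 2 - s * ((n : ℝ) + 1) ^ 2) ^ 2 * M := by
        rw [integral_const, smul_eq_mul, ← Set.univ_prod_univ, Measure.real, Measure.prod_prod]
        simp only [MeasurableSet.univ, Measure.restrict_apply, Set.univ_inter, Real.volume_Ioc]
        rw [ENNReal.toReal_mul, ENNReal.toReal_ofReal hlen0]
        ring
      calc _ ≤ ((((n : ℝ) + 1) ^ 2)⁻¹) ^ 2 * ((3 * s * ((n : ℝ) + 1)) ^ 2 * M) := by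
            gcongr
            refine (key n).2.trans (hv.trans_le ?_)
            gcongr
        _ = _ := by field_simp; ring
  filter_upwards [hint, A, B 1 le_rfl, B 2 one_le_two] with w hw hA hB1 hB2
  have conv (s : ℝ) (n : ℕ) : ‖(((n : ℝ) + 1) ^ 2)⁻¹ • ∫ k in Set.Ioc (s * ((n : ℝ) + 1) ^ 2)
      (s * ((n : ℝ) + 2) ^ 2), ((‖Z k w‖ : ℝ) : ℂ)‖ = (((n : ℝ) + 1) ^ 2)⁻¹ *
      ∫ k in Set.Ioc (s * ((n : ℝ) + 1) ^ 2) (s * ((n : ℝ) + 2) ^ 2), ‖Z k w‖ := by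
    rw [norm_smul, integral_complex_ofReal, Complex.norm_real, Real.norm_of_nonneg (by positivity),
      Real.norm_of_nonneg (integral_nonneg fun _ => norm_nonneg _)]
  have c1 := tendsto_zero_iff_norm_tendsto_zero.1 hB1
  have c2 := tendsto_zero_iff_norm_tendsto_zero.1 hB2
  simp only [conv] at c1 c2
  simp only [one_mul] at c1
  refine tendsto_average_of_squares hw ?_ c1 c2
  have c0 := tendsto_zero_iff_norm_tendsto_zero.1 hA
  refine c0.congr fun n => ?_
  rw [norm_smul, Real.norm_of_nonneg (by positivity)]

/-- The averages over `[K, 2K]` of a function tending to `L` tend to `L`. -/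
theorem tendsto_average_of_tendsto {e : ℝ → ℂ} {L : ℂ} (he : Tendsto e atTop (𝓝 L))
    (hi : ∀ a b : ℝ, 1 ≤ a → a ≤ b → IntervalIntegrable e volume a b) :
    Tendsto (fun K : ℝ => ((K : ℂ))⁻¹ * ∫ k in K..(2 * K), e k) atTop (𝓝 L) := by
  rw [Metric.tendsto_atTop] at he ⊢
  intro ε hε
  obtain ⟨N, hN⟩ := he (ε / 2) (by positivity)
  refine ⟨max N 1, fun K hK => ?_⟩
  have hK1 : 1 ≤ K := (le_max_right _ _).trans hK
  have hKN : N ≤ K := (le_max_left _ _).trans hK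
  have hK0 : (K : ℂ) ≠ 0 := by exact_mod_cast (by linarith : K ≠ 0)
  have e1 : ((K : ℂ))⁻¹ * (∫ k in K..(2 * K), e k) - L =
      ((K : ℂ))⁻¹ * ∫ k in K..(2 * K), (e k - L) := by
    rw [intervalIntegral.integral_sub (hi _ _ hK1 (by linarith)) (by simp),
      intervalIntegral.integral_const, mul_sub]
    congr 1
    rw [show 2 * K - K = K by ring, Complex.real_smul, inv_mul_cancel_left₀ hK0]
  have e2 : ‖∫ k in K..(2 * K), (e k - L)‖ ≤ ε / 2 * |2 * K - K| := by
    refine intervalIntegral.norm_integral_le_of_norm_le_const fun k hk => ?_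
    rw [Set.uIoc_of_le (by linarith)] at hk
    rw [← dist_eq_norm]
    exact (hN k (by linarith [hk.1])).le
  rw [dist_eq_norm, e1, norm_mul, norm_inv, Complex.norm_real, Real.norm_of_nonneg (by linarith)]
  rw [show 2 * K - K = K by ring, abs_of_nonneg (by linarith)] at e2
  calc K⁻¹ * ‖∫ k in K..(2 * K), (e k - L)‖ ≤ K⁻¹ * (ε / 2 * K) := by gcongr
    _ = ε / 2 := by field_simp
    _ < ε := by linarith

end Ergodic

/-! ### Continuity of modulated test functions -/

/-- The derivatives of a partial map are restrictions of the joint ones; in particular they depend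
continuously on the parameter. -/
theorem iteratedFDeriv_comp_prodMk {E F G : Type*} [NormedAddCommGroup E] [NormedSpace ℝ E]
    [NormedAddCommGroup F] [NormedSpace ℝ F] [NormedAddCommGroup G] [NormedSpace ℝ G]
    {f : E × F → G} (hf : ContDiff ℝ ∞ f) (i : ℕ) (t : E) (x : F) :
    iteratedFDeriv ℝ i (fun y => f (t, y)) x =
      (iteratedFDeriv ℝ i f (t, x)).compContinuousLinearMap
        fun _ => ContinuousLinearMap.inr ℝ E F := by
  have h1 : (fun y => f (t, y)) =
      (fun z => f (z + (t, 0))) ∘ (ContinuousLinearMap.inr ℝ E F) := by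
    ext y; simp
  rw [h1, ContinuousLinearMap.iteratedFDeriv_comp_right (n := ∞) _ (by fun_prop) x
    (by exact_mod_cast le_top), iteratedFDeriv_comp_add_right]
  simp

theorem continuous_boundedContinuousFunction_of_support {T E F : Type*} [TopologicalSpace T]
    [TopologicalSpace E] [NormedAddCommGroup F]
    {g : T → BoundedContinuousFunction E F} (hg : Continuous fun z : T × E => g z.1 z.2)
    {K : Set E} (hK : IsCompact K) (h0 : ∀ t, ∀ x ∉ K, g t x = 0) : Continuous g := by
  refine continuous_iff_continuousAt.2 fun t₀ => ?_
  refine BoundedContinuousFunction.tendsto_iff_tendstoUniformly.2 ?_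
  let c : C(T, C(E, F)) := ContinuousMap.curry ⟨fun z : T × E => g z.1 z.2, hg⟩
  have hc := (ContinuousMap.tendsto_iff_forall_isCompact_tendstoUniformlyOn.1
    (c.continuous.tendsto t₀)) K hK
  intro u hu
  filter_upwards [hc u hu] with t ht x
  by_cases hx : x ∈ K
  · exact ht x hx
  · rw [h0 t x hx, h0 t₀ x hx]
    exact refl_mem_uniformity hu

/-- All the modulated functions are supported in the support of `χ`, so continuity can be checked in
the space of smooth functions supported there, one derivative at a time. -/
theorem continuous_mulTest_planeWave {d : ℕ} (χ : Test d) (θ : Space d) :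
    Continuous fun k : ℝ => mulTest χ (planeWave θ k) (contDiff_planeWave θ k) := by
  let K : TopologicalSpace.Compacts (Space d) := ⟨tsupport χ, χ.hasCompactSupport⟩
  let F : ℝ × Space d → ℂ := fun z => χ z.2 * planeWave θ z.1 z.2
  have hF : ContDiff ℝ ∞ F := by
    refine (χ.contDiff.comp contDiff_snd).mul ?_
    unfold planeWave
    refine Complex.contDiff_exp.comp (contDiff_const.mul ?_).neg
    exact Complex.ofRealCLM.contDiff.comp
      (contDiff_fst.mul (contDiff_const.inner ℝ contDiff_snd))
  have hsupp (k : ℝ) : Function.support (fun x => F (k, x)) ⊆ K := fun x hx =>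
    subset_tsupport _ (left_ne_zero_of_mul hx)
  let p : ℝ → 𝓓_{K}(Space d, ℂ) := fun k =>
    ContDiffMapSupportedIn.of_support_subset (f := fun x => F (k, x))
      (hF.comp (contDiff_const.prodMk contDiff_id)) (hsupp k)
  have hp : Continuous p := by
    refine (ContDiffMapSupportedIn.continuous_iff_comp p).2 fun i => ?_
    have e (k : ℝ) (x : Space d) : (ContDiffMapSupportedIn.structureMapCLM ℝ ⊤ i ∘ p) k x =
        (iteratedFDeriv ℝ i F (k, x)).compContinuousLinearMap
          fun _ => ContinuousLinearMap.inr ℝ ℝ (Space d) := by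
      rw [← iteratedFDeriv_comp_prodMk hF]
      exact congrFun (ContDiffMapSupportedIn.structureMapCLM_top_apply ℝ (p k)) x
    refine continuous_boundedContinuousFunction_of_support (K := K) ?_ K.isCompact fun k x hx => ?_
    · simp_rw [e]
      have h1 : Continuous fun z : ℝ × Space d => iteratedFDeriv ℝ i F (z.1, z.2) :=
        hF.continuous_iteratedFDeriv (by exact_mod_cast le_top)
      exact (ContinuousMultilinearMap.compContinuousLinearMapL (F := ℂ)
        (fun _ : Fin i => ContinuousLinearMap.inr ℝ ℝ (Space d))).continuous.comp h1
    · have h := (p k).iteratedFDeriv_zero_on_compl (i := i) hx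
      have h' := congrFun (ContDiffMapSupportedIn.structureMapCLM_top_apply ℝ (i := i) (p k)) x
      exact h'.trans h
  have := (TestFunction.continuous_ofSupportedIn (n := ⊤) (F := ℂ)
    (Ω := (⊤ : TopologicalSpace.Opens (Space d))) (K := K) (fun _ _ => trivial)).comp hp
  exact this

/-! ### Fourier transforms of test functions -/

section Hat

variable {d : ℕ}

/-- The Fourier transform of a test function is a Schwartz function. -/
theorem exists_schwartz_hat (χ : Test d) :
    ∃ S : SchwartzMap (Space d) ℂ, (∀ ξ, S ξ = hat χ ξ) ∧
      ∀ x, ((((2 * Real.pi) ^ d)⁻¹ : ℝ) : ℂ) *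
        ∫ ξ, Complex.exp (Complex.I * ((inner ℝ x ξ : ℝ) : ℂ)) * hat χ ξ = χ x := by
  have hpi : (2 * Real.pi) ≠ 0 := by positivity
  let S₀ : SchwartzMap (Space d) ℂ := χ.hasCompactSupport.toSchwartzMap χ.contDiff
  have hS₀ (x : Space d) : S₀ x = χ x := rfl
  let e : Space d ≃L[ℝ] Space d := ContinuousLinearEquiv.smulLeft (Units.mk0 (2 * Real.pi)⁻¹
    (inv_ne_zero hpi))
  have hhat (ξ : Space d) : (𝓕 (S₀ : Space d → ℂ)) ((2 * Real.pi)⁻¹ • ξ) = hat χ ξ := by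
    rw [Real.fourier_eq', hat]
    refine integral_congr_ae (ae_of_all _ fun x => ?_)
    simp only [inner_smul_right, smul_eq_mul, hS₀]
    congr 2
    push_cast
    field_simp
  refine ⟨SchwartzMap.compCLMOfContinuousLinearEquiv ℝ e (𝓕 S₀), fun ξ => ?_, fun x => ?_⟩
  · rw [← hhat, ← SchwartzMap.fourier_coe]
    rfl
  · have hinv : 𝓕⁻ (𝓕 (S₀ : Space d → ℂ)) = S₀ := by
      rw [← SchwartzMap.fourier_coe, ← SchwartzMap.fourierInv_coe,
        FourierTransform.fourierInv_fourier_eq]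
    have h := congrFun hinv x
    rw [hS₀, Real.fourierInv_eq'] at h
    rw [← h]
    have hsc := Measure.integral_comp_smul (volume : Measure (Space d)) (fun ξ : Space d =>
      Complex.exp (((2 * Real.pi * inner ℝ ξ x : ℝ) : ℂ) * Complex.I) •
        𝓕 (S₀ : Space d → ℂ) ξ) (2 * Real.pi)⁻¹
    rw [finrank_euclideanSpace_fin] at hsc
    have hl (ξ : Space d) : Complex.exp (((2 * Real.pi * inner ℝ ((2 * Real.pi)⁻¹ • ξ) x : ℝ) : ℂ) *
        Complex.I) • 𝓕 (S₀ : Space d → ℂ) ((2 * Real.pi)⁻¹ • ξ) =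
        Complex.exp (Complex.I * ((inner ℝ x ξ : ℝ) : ℂ)) * hat χ ξ := by
      rw [hhat, smul_eq_mul, inner_smul_left, real_inner_comm]
      congr 2
      simp only [map_inv₀, conj_trivial]
      rw [mul_inv_cancel_left₀ hpi, mul_comm]
    simp_rw [hl] at hsc
    rw [hsc, Complex.real_smul, ← mul_assoc, ← Complex.ofReal_mul]
    have : ((2 * Real.pi) ^ d)⁻¹ * |((2 * Real.pi)⁻¹ ^ d)⁻¹| = 1 := by
      rw [abs_of_pos (by positivity), inv_pow, inv_inv]
      exact inv_mul_cancel₀ (by positivity)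
    rw [this, Complex.ofReal_one, one_mul]

theorem continuous_hat (χ : Test d) : Continuous (hat χ) := by
  obtain ⟨S, hS, -⟩ := exists_schwartz_hat χ
  exact S.continuous.congr hS

theorem integrable_rpow_mul_norm_hat (χ : Test d) (p : ℝ) :
    Integrable fun η : Space d => (1 + ‖η‖) ^ p * ‖hat χ η‖ := by
  obtain ⟨S, hS, -⟩ := exists_schwartz_hat χ
  obtain ⟨n, hn⟩ := exists_nat_ge p
  have h0 := S.integrable_pow_mul volume 0
  have h1 := S.integrable_pow_mul volume n
  simp only [pow_zero, one_mul, hS] at h0 h1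
  refine ((h0.add h1).const_mul (2 ^ (n - 1))).mono' ?_ (ae_of_all _ fun η => ?_)
  · refine Continuous.aestronglyMeasurable (Continuous.mul ?_ (continuous_hat χ).norm)
    exact (by fun_prop : Continuous fun η : Space d => 1 + ‖η‖).rpow_const
      fun η => Or.inl (by positivity)
  · rw [Real.norm_of_nonneg (by positivity)]
    simp only [Pi.add_apply]
    calc (1 + ‖η‖) ^ p * ‖hat χ η‖ ≤ (1 + ‖η‖) ^ (n : ℝ) * ‖hat χ η‖ := by
          gcongr
          linarith [norm_nonneg η]
      _ ≤ (2 ^ (n - 1) * (1 ^ n + ‖η‖ ^ n)) * ‖hat χ η‖ := by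
          rw [Real.rpow_natCast]
          gcongr
          exact add_pow_le zero_le_one (norm_nonneg η) n
      _ = _ := by ring

theorem fourier_inversion_hat (χ : Test d) (x : Space d) :
    ((((2 * Real.pi) ^ d)⁻¹ : ℝ) : ℂ) *
      ∫ ξ, Complex.exp (Complex.I * ((inner ℝ x ξ : ℝ) : ℂ)) * hat χ ξ = χ x := by
  obtain ⟨S, -, h⟩ := exists_schwartz_hat χ
  exact h x

/-- The test function `χ` modulated by the plane wave `y ↦ e^{-i t θ·y}`. -/
noncomputable abbrev modTest (χ : Test d) (θ : Space d) (t : ℝ) : Test d :=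
  mulTest χ (planeWave θ t) (contDiff_planeWave θ t)

theorem modTest_apply (χ : Test d) (θ : Space d) (t : ℝ) (x : Space d) :
    modTest χ θ t x = χ x * Complex.exp (-(Complex.I * ((t * inner ℝ θ x : ℝ) : ℂ))) := rfl

theorem hat_modTest (χ : Test d) (θ : Space d) (t : ℝ) (ξ : Space d) :
    hat (modTest χ θ t) ξ = hat χ (ξ + t • θ) := by
  unfold hat
  refine integral_congr_ae (ae_of_all _ fun x => ?_)
  simp only [modTest_apply]
  rw [mul_comm (χ x), ← mul_assoc, ← Complex.exp_add]
  congr 2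
  rw [inner_add_right, inner_smul_right, real_inner_comm θ x]
  push_cast
  ring

/-- After the shift `η = ξ + tθ` of the frequency, `Op(σ)` applied to a modulated test function
samples the symbol near `-tθ`. -/
theorem pseudoDiff_modTest (σ : Space d → Space d → ℂ) (χ : Test d) (θ : Space d) (t : ℝ)
    (x : Space d) :
    pseudoDiff σ (modTest χ θ t) x = ((((2 * Real.pi) ^ d)⁻¹ : ℝ) : ℂ) *
      ∫ η, Complex.exp (Complex.I * ((inner ℝ x (η - t • θ) : ℝ) : ℂ)) * σ x (η - t • θ) *
        hat χ η := by
  unfold pseudoDiff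
  congr 1
  rw [← integral_sub_right_eq_self _ (t • θ)]
  refine integral_congr_ae (ae_of_all _ fun η => ?_)
  simp only [hat_modTest, sub_add_cancel]

end Hat

/-! ### Symbol estimates -/

section Symbol

variable {d : ℕ}

theorem IsSymbol.norm_le {s : ℝ} {a : Space d → Space d → ℂ} (ha : IsSymbol s a) :
    ∃ C, 0 ≤ C ∧ ∀ x ξ, ‖a x ξ‖ ≤ C * (1 + ‖ξ‖) ^ s ∧
      ‖fderiv ℝ (fun y => a y ξ) x‖ ≤ C * (1 + ‖ξ‖) ^ s := by
  obtain ⟨C₀, h₀⟩ := ha.2 0 0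
  obtain ⟨C₁, h₁⟩ := ha.2 1 0
  refine ⟨max 0 (max C₀ C₁), le_max_left _ _, fun x ξ => ?_⟩
  have e : (fun y => iteratedFDeriv ℝ 0 (a y) ξ) =
      (continuousMultilinearCurryFin0 ℝ (Space d) ℂ).symm ∘ fun y => a y ξ := by
    funext y
    simp only [iteratedFDeriv_zero_eq_comp, Function.comp_apply]
  have k0 := h₀ x ξ (norm_nonneg _)
  have k1 := h₁ x ξ (norm_nonneg _)
  rw [e, LinearIsometryEquiv.norm_iteratedFDeriv_comp_left, Nat.cast_zero, sub_zero] at k0 k1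
  rw [norm_iteratedFDeriv_zero] at k0
  rw [norm_iteratedFDeriv_one] at k1
  have hp : (0 : ℝ) ≤ (1 + ‖ξ‖) ^ s := by positivity
  constructor
  · refine k0.trans (mul_le_mul_of_nonneg_right ?_ hp)
    exact (le_max_left _ _).trans (le_max_right _ _)
  · refine k1.trans (mul_le_mul_of_nonneg_right ?_ hp)
    exact (le_max_right _ _).trans (le_max_right _ _)

theorem IsClassicalSymbol.norm_sub_le {s : ℝ} {a p : Space d → Space d → ℂ}
    (ha : IsClassicalSymbol s a p) :
    ∃ C, ∀ x ξ, 1 ≤ ‖ξ‖ → ‖a x ξ - p x ξ‖ ≤ C * (1 + ‖ξ‖) ^ (s - 1) := by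
  obtain ⟨-, t, ht0, -, -, ht⟩ := ha
  obtain ⟨C, hC⟩ := ht 1 0 0
  refine ⟨C, fun x ξ hξ => ?_⟩
  have h := hC x ξ hξ
  have hξ0 : ξ ≠ 0 := norm_pos_iff.1 (by linarith)
  rw [norm_iteratedFDeriv_zero, norm_iteratedFDeriv_zero] at h
  simpa [ht0 x ξ hξ0] using h

theorem rpow_neg_le_of_comparable {a b L : ℝ} (m : ℝ) (ha : 0 < a) (hb : 0 < b) (hab : a ≤ L * b)
    (hba : b ≤ L * a) : a ^ (-m) ≤ L ^ |m| * b ^ (-m) := by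
  have hL : 0 < L := (pos_iff_pos_of_mul_pos (ha.trans_le hab)).2 hb
  rcases le_total 0 m with hm | hm
  · rw [abs_of_nonneg hm, Real.rpow_neg ha.le, Real.rpow_neg hb.le, ← div_eq_mul_inv,
      ← one_div, div_le_div_iff₀ (by positivity) (by positivity), one_mul,
      ← Real.mul_rpow hL.le ha.le]
    exact Real.rpow_le_rpow hb.le hba hm
  · rw [abs_of_nonpos hm, ← Real.mul_rpow hL.le hb.le]
    exact Real.rpow_le_rpow ha.le hab (by linarith)

/-- Peetre's inequality. -/
theorem peetre {θ : Space d} (hθ : ‖θ‖ = 1) (m t : ℝ) (η : Space d) :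
    (1 + ‖η - t • θ‖) ^ (-m) ≤ (1 + ‖η‖) ^ |m| * (1 + |t|) ^ (-m) := by
  have ht : ‖t • θ‖ = |t| := by rw [norm_smul, hθ, mul_one, Real.norm_eq_abs]
  have h1 := norm_sub_le η (t • θ)
  have h2 : ‖t • θ‖ ≤ ‖η‖ + ‖η - t • θ‖ := by
    have := norm_sub_le η (η - t • θ)
    simpa using this
  rw [ht] at h1 h2
  refine rpow_neg_le_of_comparable m (by positivity) (by positivity) ?_ ?_ <;>
    nlinarith [norm_nonneg η, norm_nonneg (η - t • θ), abs_nonneg t,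
      mul_nonneg (norm_nonneg η) (norm_nonneg (η - t • θ)),
      mul_nonneg (norm_nonneg η) (abs_nonneg t)]

end Symbol

/-! ### The kernel form on modulated test functions -/

section Osc

variable {d : ℕ}

/-- The form `(φ, ψ) ↦ ∫ φ Op(σ) ψ` at `φ = c e^{i s θ·x}` and `ψ = χ e^{-i t θ·x}`. -/
noncomputable def modForm (σ : Space d → Space d → ℂ) (θ : Space d) (c χ : Test d) (s t : ℝ) : ℂ :=
  ∫ x, modTest c θ (-s) x * pseudoDiff σ (modTest χ θ t) x

/-- One integration by parts in the direction `θ`: it gains the factor `r⁻¹` at the cost of one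
derivative of the amplitude, which is of size `1 + ‖η‖`. -/
theorem norm_mul_integral_exp_le {θ : Space d} (hθ : ‖θ‖ = 1) (c : Test d) {a : Space d → ℂ}
    (ha : ContDiff ℝ 1 a) {A : ℝ} (hA : ∀ x, ‖a x‖ ≤ A ∧ ‖fderiv ℝ a x‖ ≤ A) (r : ℝ)
    (η : Space d) :
    ‖(r : ℂ) * ∫ x, Complex.exp (Complex.I * ((r * inner ℝ θ x : ℝ) : ℂ)) *
        (c x * Complex.exp (Complex.I * ((inner ℝ x η : ℝ) : ℂ)) * a x)‖ ≤
      A * (1 + ‖η‖) * ∫ x, (‖c x‖ + ‖fderiv ℝ c x‖) := by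
  have hA0 : 0 ≤ A := (norm_nonneg _).trans (hA 0).1
  have hc1 : ContDiff ℝ 1 c := c.contDiff.of_le (by exact_mod_cast le_top)
  set u : Space d → ℂ := fun x => Complex.exp (Complex.I * ((r * inner ℝ θ x : ℝ) : ℂ)) with hu
  set q : Space d → ℂ := fun x => Complex.exp (Complex.I * ((inner ℝ x η : ℝ) : ℂ)) with hq
  set v : Space d → ℂ := fun x => c x * q x * a x with hv
  have hud (x : Space d) : HasFDerivAt u (u x • (Complex.I •
      (Complex.ofRealCLM ∘L (r • innerSL ℝ θ)))) x := by
    have h1 : HasFDerivAt (fun x : Space d => r * inner ℝ θ x) (r • innerSL ℝ θ) x :=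
      ((innerSL ℝ θ).hasFDerivAt).const_mul r
    exact ((Complex.ofRealCLM.hasFDerivAt.comp x h1).const_mul Complex.I).cexp
  have hqd (x : Space d) : HasFDerivAt q (q x • (Complex.I •
      (Complex.ofRealCLM ∘L (innerSL ℝ η)))) x := by
    have h1 : HasFDerivAt (fun x : Space d => inner ℝ x η) (innerSL ℝ η) x := by
      simp_rw [real_inner_comm η]
      exact (innerSL ℝ η).hasFDerivAt
    exact ((Complex.ofRealCLM.hasFDerivAt.comp x h1).const_mul Complex.I).cexp
  have hun (x : Space d) : ‖u x‖ = 1 := Complex.norm_exp_I_mul_ofReal _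
  have hqn (x : Space d) : ‖q x‖ = 1 := Complex.norm_exp_I_mul_ofReal _
  have hqC : ContDiff ℝ 1 q := Complex.contDiff_exp.comp
    (contDiff_const.mul (Complex.ofRealCLM.contDiff.comp (contDiff_id.inner ℝ contDiff_const)))
  have huC : ContDiff ℝ 1 u := Complex.contDiff_exp.comp (contDiff_const.mul
    (Complex.ofRealCLM.contDiff.comp (contDiff_const.mul (contDiff_const.inner ℝ contDiff_id))))
  have hvC : ContDiff ℝ 1 v := (hc1.mul hqC).mul ha
  have hvs : HasCompactSupport v := (c.hasCompactSupport.mul_right).mul_right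
  have hcd (x : Space d) := (hc1.differentiable one_ne_zero x).hasFDerivAt
  have had (x : Space d) := (ha.differentiable one_ne_zero x).hasFDerivAt
  have hvd (x : Space d) : ‖fderiv ℝ v x θ‖ ≤ A * (1 + ‖η‖) * (‖c x‖ + ‖fderiv ℝ c x‖) := by
    have h := (((hcd x).mul (hqd x)).mul (had x)).fderiv
    have e : fderiv ℝ v x θ = c x * q x * fderiv ℝ a x θ +
        a x * (c x * (q x * (Complex.I * ((inner ℝ η θ : ℝ) : ℂ))) + q x * fderiv ℝ c x θ) := by
      have := congrArg (fun L : Space d →L[ℝ] ℂ => L θ) h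
      rw [mul_add]
      simp at this
      exact this
    have i1 : ‖(inner ℝ η θ : ℝ)‖ ≤ ‖η‖ := by
      simpa [hθ] using norm_inner_le_norm (𝕜 := ℝ) η θ
    have i2 : ‖fderiv ℝ a x θ‖ ≤ A := by
      have := (fderiv ℝ a x).le_opNorm θ
      rw [hθ, mul_one] at this
      exact this.trans (hA x).2
    have i3 : ‖fderiv ℝ c x θ‖ ≤ ‖fderiv ℝ c x‖ := by
      have := (fderiv ℝ c x).le_opNorm θ
      rwa [hθ, mul_one] at this
    rw [e]
    calc _ ≤ ‖c x‖ * A + A * (‖c x‖ * ‖η‖ + ‖fderiv ℝ c x‖) := by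
          refine (norm_add_le _ _).trans (add_le_add ?_ ?_)
          · rw [norm_mul, norm_mul, hqn, mul_one]
            gcongr
          · rw [norm_mul]
            gcongr
            · exact (hA x).1
            · refine (norm_add_le _ _).trans (add_le_add ?_ ?_)
              · rw [norm_mul, norm_mul, norm_mul, hqn, Complex.norm_I, one_mul, one_mul,
                  Complex.norm_real]
                gcongr
              · rw [norm_mul, hqn, one_mul]
                exact i3
      _ ≤ _ := by nlinarith [mul_nonneg hA0 (mul_nonneg (norm_nonneg η)
            (norm_nonneg (fderiv ℝ c x)))]
  have hvi : Continuous fun x => fderiv ℝ v x θ :=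
    (hvC.continuous_fderiv one_ne_zero).clm_apply continuous_const
  have hvis : HasCompactSupport fun x => fderiv ℝ v x θ :=
    (hvs.fderiv (𝕜 := ℝ)).comp_left (g := fun L : Space d →L[ℝ] ℂ => L θ) (by simp)
  have hue (x : Space d) : fderiv ℝ u x θ = Complex.I * r * u x := by
    rw [(hud x).fderiv]
    simp [hθ]
    ring
  have ibp := integral_mul_fderiv_eq_neg_fderiv_mul_of_integrable (μ := volume) (f := u) (g := v)
    (v := θ) (𝕜 := ℂ) (by
      have : Continuous fun x => fderiv ℝ u x θ * v x := by
        simp_rw [hue]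
        exact (continuous_const.mul huC.continuous).mul hvC.continuous
      exact this.integrable_of_hasCompactSupport hvs.mul_left)
    ((huC.continuous.mul hvi).integrable_of_hasCompactSupport hvis.mul_left)
    ((huC.continuous.mul hvC.continuous).integrable_of_hasCompactSupport hvs.mul_left)
    (fun x _ => huC.differentiable one_ne_zero x) (fun x _ => hvC.differentiable one_ne_zero x)
  simp_rw [hue, mul_assoc (Complex.I * r), integral_const_mul] at ibp
  have hcc : Integrable fun x => ‖c x‖ + ‖fderiv ℝ c x‖ := by
    have h1 := c.continuous.integrable_of_hasCompactSupport (μ := volume) c.hasCompactSupport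
    have h2 := (hc1.continuous_fderiv one_ne_zero).integrable_of_hasCompactSupport (μ := volume)
      (c.hasCompactSupport.fderiv (𝕜 := ℝ))
    exact h1.norm.add h2.norm
  calc ‖(r : ℂ) * ∫ x, u x * v x‖ = ‖∫ x, u x * fderiv ℝ v x θ‖ := by
        rw [ibp, norm_neg, norm_mul, norm_mul, norm_mul, Complex.norm_I, one_mul]
    _ ≤ ∫ x, A * (1 + ‖η‖) * (‖c x‖ + ‖fderiv ℝ c x‖) := by
        refine norm_integral_le_of_norm_le (hcc.const_mul _) (ae_of_all _ fun x => ?_)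
        rw [norm_mul, hun, one_mul]
        exact hvd x
    _ = _ := integral_const_mul _ _

theorem modForm_integrand (σ : Space d → Space d → ℂ) (θ : Space d) (c χ : Test d) (s t : ℝ)
    (x η : Space d) :
    modTest c θ (-s) x * (Complex.exp (Complex.I * ((inner ℝ x (η - t • θ) : ℝ) : ℂ)) *
      σ x (η - t • θ) * hat χ η) =
    hat χ η * (Complex.exp (Complex.I * (((s - t) * inner ℝ θ x : ℝ) : ℂ)) *
      (c x * Complex.exp (Complex.I * ((inner ℝ x η : ℝ) : ℂ)) * σ x (η - t • θ))) := by
  have e : Complex.exp (-(Complex.I * ((-s * inner ℝ θ x : ℝ) : ℂ))) *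
      Complex.exp (Complex.I * ((inner ℝ x (η - t • θ) : ℝ) : ℂ)) =
      Complex.exp (Complex.I * (((s - t) * inner ℝ θ x : ℝ) : ℂ)) *
        Complex.exp (Complex.I * ((inner ℝ x η : ℝ) : ℂ)) := by
    rw [← Complex.exp_add, ← Complex.exp_add, inner_sub_right, inner_smul_right,
      real_inner_comm θ x]
    congr 1
    push_cast
    ring
  rw [modTest_apply]
  linear_combination (c x * σ x (η - t • θ) * hat χ η) * e

/-- The form is of size `(1 + |t|)^{-m}` and decays in `|s - t|`. -/
theorem exists_modForm_le {σ : Space d → Space d → ℂ} {m : ℝ} (hσ : IsSymbol (-m) σ)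
    {θ : Space d} (hθ : ‖θ‖ = 1) (c χ : Test d) :
    ∃ M, 0 ≤ M ∧ ∀ s t : ℝ, (1 + |s - t|) * ‖modForm σ θ c χ s t‖ ≤ M * (1 + |t|) ^ (-m) := by
  obtain ⟨C, hC0, hC⟩ := hσ.norm_le
  have hσc : Continuous fun z : Space d × Space d => σ z.1 z.2 := hσ.1.continuous
  obtain ⟨I, hI⟩ : ∃ I : ℝ, I = ∫ x, (‖c x‖ + ‖fderiv ℝ c x‖) := ⟨_, rfl⟩
  have hc1 : ContDiff ℝ 1 c := c.contDiff.of_le (by exact_mod_cast le_top)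
  have hci : Integrable fun x => ‖c x‖ :=
    (c.continuous.integrable_of_hasCompactSupport c.hasCompactSupport).norm
  have hci' : Integrable fun x => ‖c x‖ + ‖fderiv ℝ c x‖ :=
    hci.add ((hc1.continuous_fderiv one_ne_zero).integrable_of_hasCompactSupport (μ := volume)
      (c.hasCompactSupport.fderiv (𝕜 := ℝ))).norm
  have hI0 : 0 ≤ I := hI ▸ integral_nonneg fun x => by positivity
  have hw := integrable_rpow_mul_norm_hat χ (|m| + 1)
  have hw0 := integrable_rpow_mul_norm_hat χ |m|
  obtain ⟨W, hW⟩ : ∃ W : ℝ, W = ∫ η : Space d, (1 + ‖η‖) ^ (|m| + 1) * ‖hat χ η‖ := ⟨_, rfl⟩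
  have hW0 : 0 ≤ W := hW ▸ integral_nonneg fun η => by positivity
  obtain ⟨κ, hκ⟩ : ∃ κ : ℝ, κ = ((2 * Real.pi) ^ d)⁻¹ := ⟨_, rfl⟩
  have hκ0 : 0 ≤ κ := hκ ▸ by positivity
  refine ⟨κ * (2 * C * I * W), by positivity, fun s t => ?_⟩
  have ht0 : (0 : ℝ) ≤ (1 + |t|) ^ (-m) := by positivity
  have hCt (x η : Space d) : C * (1 + ‖η - t • θ‖) ^ (-m) ≤
      C * (1 + |t|) ^ (-m) * (1 + ‖η‖) ^ |m| := by
    have h := mul_le_mul_of_nonneg_left (peetre hθ m t η) hC0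
    linarith
  let E : Space d → Space d → ℂ := fun x η =>
    Complex.exp (Complex.I * (((s - t) * inner ℝ θ x : ℝ) : ℂ)) *
      (c x * Complex.exp (Complex.I * ((inner ℝ x η : ℝ) : ℂ)) * σ x (η - t • θ))
  have hEn (x η : Space d) : ‖E x η‖ ≤ ‖c x‖ * (C * (1 + |t|) ^ (-m) * (1 + ‖η‖) ^ |m|) := by
    simp only [E]
    rw [norm_mul, norm_mul, norm_mul, Complex.norm_exp_I_mul_ofReal, Complex.norm_exp_I_mul_ofReal,
      one_mul, mul_one]
    exact mul_le_mul_of_nonneg_left ((hC _ _).1.trans (hCt x η)) (norm_nonneg _)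
  have hEc : Continuous fun z : Space d × Space d => hat χ z.2 * E z.1 z.2 := by
    have := continuous_hat χ
    have hc := c.continuous
    have h2 : Continuous fun z : Space d × Space d => σ z.1 (z.2 - t • θ) :=
      hσc.comp (by fun_prop : Continuous fun z : Space d × Space d => (z.1, z.2 - t • θ))
    simp only [E]
    fun_prop
  have hint : Integrable (fun z : Space d × Space d => hat χ z.2 * E z.1 z.2)
      (volume.prod volume) := by
    have hb := (hci.mul_prod hw0).const_mul (C * (1 + |t|) ^ (-m))
    refine hb.mono' hEc.aestronglyMeasurable (ae_of_all _ fun z => ?_)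
    rw [norm_mul]
    calc _ ≤ ‖hat χ z.2‖ * (‖c z.1‖ * (C * (1 + |t|) ^ (-m) * (1 + ‖z.2‖) ^ |m|)) := by
          gcongr
          exact hEn _ _
      _ = _ := by ring
  have hform : modForm σ θ c χ s t = (κ : ℂ) * ∫ η, hat χ η * ∫ x, E x η := by
    have h1 : ∫ x, ∫ η, hat χ η * E x η = ∫ η, ∫ x, hat χ η * E x η :=
      integral_integral_swap (f := fun x η => hat χ η * E x η) hint
    simp_rw [integral_const_mul] at h1
    rw [← h1, modForm, ← integral_const_mul]
    refine integral_congr_ae (ae_of_all _ fun x => ?_)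
    simp only [pseudoDiff_modTest, ← hκ]
    rw [mul_left_comm, ← integral_const_mul]
    simp_rw [modForm_integrand]
    rfl
  have hin (η : Space d) : (1 + |s - t|) * ‖∫ x, E x η‖ ≤
      2 * (C * (1 + |t|) ^ (-m) * (1 + ‖η‖) ^ (|m| + 1)) * I := by
    have hA := hCt 0 η
    have hpos : (0 : ℝ) ≤ C * (1 + |t|) ^ (-m) * (1 + ‖η‖) ^ |m| := by positivity
    have h1 := norm_mul_integral_exp_le hθ c (a := fun x => σ x (η - t • θ))
      (A := C * (1 + |t|) ^ (-m) * (1 + ‖η‖) ^ |m|)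
      ((hσ.1.comp (contDiff_id.prodMk contDiff_const)).of_le (by exact_mod_cast le_top))
      (fun x => ⟨(hC x _).1.trans hA, (hC x _).2.trans hA⟩) (s - t) η
    rw [norm_mul, Complex.norm_real, Real.norm_eq_abs, ← hI] at h1
    have h2 : ‖∫ x, E x η‖ ≤ C * (1 + |t|) ^ (-m) * (1 + ‖η‖) ^ |m| * I := by
      calc ‖∫ x, E x η‖ ≤ ∫ x, C * (1 + |t|) ^ (-m) * (1 + ‖η‖) ^ |m| *
            (‖c x‖ + ‖fderiv ℝ c x‖) := by
            refine norm_integral_le_of_norm_le (hci'.const_mul _) (ae_of_all _ fun x => ?_)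
            refine (hEn x η).trans ?_
            rw [mul_comm]
            gcongr
            linarith [norm_nonneg (fderiv ℝ c x)]
        _ = _ := by rw [integral_const_mul, hI]
    rw [Real.rpow_add (by positivity), Real.rpow_one, add_mul, one_mul]
    have h3 : C * (1 + |t|) ^ (-m) * (1 + ‖η‖) ^ |m| * I ≤
        C * (1 + |t|) ^ (-m) * (1 + ‖η‖) ^ |m| * (1 + ‖η‖) * I := by
      refine mul_le_mul_of_nonneg_right ?_ hI0
      exact le_mul_of_one_le_right hpos (by linarith [norm_nonneg η])
    calc _ ≤ C * (1 + |t|) ^ (-m) * (1 + ‖η‖) ^ |m| * I +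
          C * (1 + |t|) ^ (-m) * (1 + ‖η‖) ^ |m| * (1 + ‖η‖) * I := add_le_add h2 h1
      _ ≤ _ := by linarith
  rw [hform, norm_mul, Complex.norm_real, Real.norm_of_nonneg hκ0]
  have hs0 : (0 : ℝ) ≤ 1 + |s - t| := by positivity
  have hfin : ‖((1 + |s - t| : ℝ) : ℂ) * ∫ η, hat χ η * ∫ x, E x η‖ ≤
      2 * C * (1 + |t|) ^ (-m) * I * W := by
    rw [← integral_const_mul, hW, ← integral_const_mul]
    refine norm_integral_le_of_norm_le (hw.const_mul _) (ae_of_all _ fun η => ?_)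
    rw [norm_mul, norm_mul, Complex.norm_real, Real.norm_of_nonneg hs0]
    calc _ = ‖hat χ η‖ * ((1 + |s - t|) * ‖∫ x, E x η‖) := by ring
      _ ≤ ‖hat χ η‖ * (2 * (C * (1 + |t|) ^ (-m) * (1 + ‖η‖) ^ (|m| + 1)) * I) :=
          mul_le_mul_of_nonneg_left (hin η) (norm_nonneg _)
      _ = _ := by ring
  rw [norm_mul, Complex.norm_real, Real.norm_of_nonneg hs0] at hfin
  calc _ = κ * ((1 + |s - t|) * ‖∫ η, hat χ η * ∫ x, E x η‖) := by ring
    _ ≤ κ * (2 * C * (1 + |t|) ^ (-m) * I * W) := by gcongr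
    _ = _ := by ring

end Osc

/-! ### Asymptotics of the kernel form along the diagonal -/

section Asymptotics

variable {d : ℕ}

theorem tendsto_norm_sub_smul_div {θ : Space d} (hθ : ‖θ‖ = 1) (τ : ℝ) (η : Space d) :
    Tendsto (fun k : ℝ => ‖η - (k + τ) • θ‖ / k) atTop (𝓝 1) := by
  have h1 : Tendsto (fun k : ℝ => ‖k⁻¹ • (η - τ • θ) - θ‖) atTop (𝓝 ‖(0 : ℝ) • (η - τ • θ) - θ‖) :=
    ((tendsto_inv_atTop_zero.smul_const _).sub_const _).norm
  rw [zero_smul, zero_sub, norm_neg, hθ] at h1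
  refine h1.congr' ?_
  filter_upwards [eventually_gt_atTop 0] with k hk
  have e : k⁻¹ • (η - τ • θ) - θ = k⁻¹ • (η - (k + τ) • θ) := by
    rw [add_smul, smul_sub, smul_sub, smul_add, smul_smul k⁻¹ k, inv_mul_cancel₀ hk.ne', one_smul]
    abel
  rw [e, norm_smul, Real.norm_of_nonneg (by positivity), div_eq_inv_mul]

theorem one_add_abs_rpow_le {τ : ℝ} (hτ : 0 ≤ τ) (m : ℝ) {k : ℝ} (hk : 1 ≤ k) :
    k ^ m * (1 + |k + τ|) ^ (-m) ≤ (2 + τ) ^ |m| := by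
  have hk0 : 0 < k := by linarith
  have h := rpow_neg_le_of_comparable (a := 1 + |k + τ|) (b := k) (L := 2 + τ) m (by positivity)
    hk0 (by rw [abs_of_nonneg (by linarith)]; nlinarith)
    (by rw [abs_of_nonneg (by linarith)]; nlinarith)
  calc k ^ m * (1 + |k + τ|) ^ (-m) ≤ k ^ m * ((2 + τ) ^ |m| * k ^ (-m)) := by gcongr
    _ = (2 + τ) ^ |m| * (k ^ m * k ^ (-m)) := by ring
    _ = (2 + τ) ^ |m| := by rw [← Real.rpow_add hk0]; simp

/-- Along `ξ = η - (k + τ) θ` the symbol approaches its principal part. -/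
theorem tendsto_rpow_mul_symbol {σ : Space d → Space d → ℂ} {m : ℝ} {μ : Space d → ℝ}
    (hσ : IsClassicalSymbol (-m) σ (fun x ξ => ((μ x * ‖ξ‖ ^ (-m) : ℝ) : ℂ)))
    {θ : Space d} (hθ : ‖θ‖ = 1) (τ : ℝ) (x η : Space d) :
    Tendsto (fun k : ℝ => ((k ^ m : ℝ) : ℂ) * σ x (η - (k + τ) • θ)) atTop (𝓝 (μ x : ℂ)) := by
  obtain ⟨C, hC⟩ := hσ.norm_sub_le
  have hr := tendsto_norm_sub_smul_div hθ τ η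
  have hn : Tendsto (fun k : ℝ => ‖η - (k + τ) • θ‖) atTop atTop := by
    have := hr.pos_mul_atTop one_pos tendsto_id
    refine this.congr' ?_
    filter_upwards [eventually_gt_atTop 0] with k hk
    simp only [id]
    field_simp
  have h1 : Tendsto (fun k : ℝ => ((1 + ‖η - (k + τ) • θ‖) / k)) atTop (𝓝 1) := by
    have := tendsto_inv_atTop_zero.add hr
    rw [zero_add] at this
    refine this.congr fun k => ?_
    rw [add_div, one_div]
  have hpow {u : ℝ → ℝ} (hu : Tendsto (fun k => u k / k) atTop (𝓝 1)) (hu0 : ∀ k, 0 ≤ u k) :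
      Tendsto (fun k => k ^ m * u k ^ (-m)) atTop (𝓝 1) := by
    have h := hu.rpow_const (p := -m) (Or.inl one_ne_zero)
    rw [Real.one_rpow] at h
    refine h.congr' ?_
    filter_upwards [eventually_gt_atTop 0] with k hk
    rw [Real.div_rpow (hu0 k) hk.le, Real.rpow_neg hk.le, div_inv_eq_mul, mul_comm]
  have hmain : Tendsto (fun k : ℝ => (((k ^ m * ‖η - (k + τ) • θ‖ ^ (-m)) * μ x : ℝ) : ℂ))
      atTop (𝓝 (μ x : ℂ)) := by
    have := (hpow hr fun k => norm_nonneg _).mul_const (μ x)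
    rw [one_mul] at this
    exact (Complex.continuous_ofReal.tendsto _).comp this
  have hrem : Tendsto (fun k : ℝ => ((k ^ m : ℝ) : ℂ) * (σ x (η - (k + τ) • θ) -
      ((μ x * ‖η - (k + τ) • θ‖ ^ (-m) : ℝ) : ℂ))) atTop (𝓝 0) := by
    have hb : Tendsto (fun k : ℝ => C * ((k ^ m * (1 + ‖η - (k + τ) • θ‖) ^ (-m)) *
        (1 + ‖η - (k + τ) • θ‖)⁻¹)) atTop (𝓝 0) := by
      have := ((hpow h1 fun k => by positivity).mul
        (tendsto_inv_atTop_zero.comp (tendsto_atTop_add_const_left _ 1 hn))).const_mul C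
      simpa [Function.comp_def] using this
    refine squeeze_zero_norm' ?_ hb
    filter_upwards [eventually_gt_atTop 0, hn.eventually_ge_atTop 1] with k hk hk1
    rw [norm_mul, Complex.norm_real, Real.norm_of_nonneg (by positivity)]
    calc _ ≤ k ^ m * (C * (1 + ‖η - (k + τ) • θ‖) ^ (-m - 1)) := by
          gcongr
          exact hC x _ hk1
      _ = _ := by
          rw [Real.rpow_sub_one (by positivity)]
          ring
  have := hmain.add hrem
  rw [add_zero] at this
  refine this.congr fun k => ?_
  push_cast
  ring

/-- The integrand of `k^m Op(σ)` applied to a test function at frequency `k + τ`, without the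
oscillating factor `e^{-i (k + τ) θ·x}`. -/
noncomputable def diagIntegrand (σ : Space d → Space d → ℂ) (m : ℝ) (θ : Space d) (τ : ℝ)
    (χ : Test d) (k : ℝ) (x η : Space d) : ℂ :=
  Complex.exp (Complex.I * ((inner ℝ x η : ℝ) : ℂ)) *
    (((k ^ m : ℝ) : ℂ) * σ x (η - (k + τ) • θ)) * hat χ η

theorem continuous_diagIntegrand {σ : Space d → Space d → ℂ} {s : ℝ} (hσ : IsSymbol s σ)
    (m : ℝ) (θ : Space d) (τ : ℝ) (χ : Test d) (k : ℝ) :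
    Continuous fun z : Space d × Space d => diagIntegrand σ m θ τ χ k z.1 z.2 := by
  have h1 : Continuous fun z : Space d × Space d => σ z.1 z.2 := hσ.1.continuous
  have h2 : Continuous fun z : Space d × Space d => σ z.1 (z.2 - (k + τ) • θ) :=
    h1.comp (continuous_fst.prodMk (continuous_snd.sub continuous_const))
  exact ((Complex.continuous_exp.comp (continuous_const.mul (Complex.continuous_ofReal.comp
    (continuous_fst.inner continuous_snd)))).mul (continuous_const.mul h2)).mul
    ((continuous_hat χ).comp continuous_snd)

theorem exists_norm_diagIntegrand_le {σ : Space d → Space d → ℂ} {m : ℝ} (hσ : IsSymbol (-m) σ)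
    {θ : Space d} (hθ : ‖θ‖ = 1) {τ : ℝ} (hτ : 0 ≤ τ) (χ : Test d) :
    ∃ C : ℝ, ∀ k, 1 ≤ k → ∀ x η : Space d,
      ‖diagIntegrand σ m θ τ χ k x η‖ ≤ C * ((1 + ‖η‖) ^ |m| * ‖hat χ η‖) := by
  obtain ⟨C, hC0, hC⟩ := hσ.norm_le
  refine ⟨C * (2 + τ) ^ |m|, fun k hk x η => ?_⟩
  have hk0 : 0 ≤ k ^ m := Real.rpow_nonneg (by linarith) m
  have h1 : k ^ m * ‖σ x (η - (k + τ) • θ)‖ ≤ C * (2 + τ) ^ |m| * (1 + ‖η‖) ^ |m| := by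
    calc _ ≤ k ^ m * (C * ((1 + ‖η‖) ^ |m| * (1 + |k + τ|) ^ (-m))) := by
          refine mul_le_mul_of_nonneg_left ((hC _ _).1.trans ?_) hk0
          exact mul_le_mul_of_nonneg_left (peetre hθ m (k + τ) η) hC0
      _ = C * (k ^ m * (1 + |k + τ|) ^ (-m)) * (1 + ‖η‖) ^ |m| := by ring
      _ ≤ _ := by
          gcongr
          exact one_add_abs_rpow_le hτ m hk
  rw [diagIntegrand, norm_mul, norm_mul, norm_mul, Complex.norm_exp_I_mul_ofReal, one_mul,
    Complex.norm_real, Real.norm_of_nonneg hk0, ← mul_assoc]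
  exact mul_le_mul_of_nonneg_right h1 (norm_nonneg _)

theorem tendsto_integral_diagIntegrand {σ : Space d → Space d → ℂ} {m : ℝ} {μ : Space d → ℝ}
    (hσ : IsClassicalSymbol (-m) σ (fun x ξ => ((μ x * ‖ξ‖ ^ (-m) : ℝ) : ℂ)))
    {θ : Space d} (hθ : ‖θ‖ = 1) {τ : ℝ} (hτ : 0 ≤ τ) (χ : Test d) (x : Space d) :
    Tendsto (fun k => ((((2 * Real.pi) ^ d)⁻¹ : ℝ) : ℂ) * ∫ η, diagIntegrand σ m θ τ χ k x η) atTop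
      (𝓝 (μ x * χ x)) := by
  obtain ⟨C, hC⟩ := exists_norm_diagIntegrand_le hσ.1 hθ hτ χ
  have hlim : Tendsto (fun k => ∫ η, diagIntegrand σ m θ τ χ k x η) atTop
      (𝓝 (∫ η, (μ x : ℂ) * (Complex.exp (Complex.I * ((inner ℝ x η : ℝ) : ℂ)) * hat χ η))) := by
    refine tendsto_integral_filter_of_dominated_convergence _
      (Eventually.of_forall fun k => ((continuous_diagIntegrand hσ.1 m θ τ χ k).comp
        (continuous_const.prodMk continuous_id)).aestronglyMeasurable) ?_
      ((integrable_rpow_mul_norm_hat χ |m|).const_mul C) (ae_of_all _ fun η => ?_)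
    · filter_upwards [eventually_ge_atTop 1] with k hk
      exact ae_of_all _ (hC k hk x)
    · have := ((tendsto_rpow_mul_symbol hσ hθ τ x η).const_mul
        (Complex.exp (Complex.I * ((inner ℝ x η : ℝ) : ℂ)))).mul_const (hat χ η)
      refine this.trans_eq ?_
      ring_nf
  have h := hlim.const_mul ((((2 * Real.pi) ^ d)⁻¹ : ℝ) : ℂ)
  rwa [integral_const_mul, mul_left_comm, fourier_inversion_hat] at h

theorem rpow_mul_modForm_eq (σ : Space d → Space d → ℂ) (m : ℝ) (θ : Space d) (τ : ℝ)
    (c χ : Test d) (k : ℝ) :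
    ((k ^ m : ℝ) : ℂ) * modForm σ θ c χ k (k + τ) =
      ∫ x, c x * Complex.exp (-(Complex.I * ((inner ℝ x (τ • θ) : ℝ) : ℂ))) *
        (((((2 * Real.pi) ^ d)⁻¹ : ℝ) : ℂ) * ∫ η, diagIntegrand σ m θ τ χ k x η) := by
  rw [modForm, ← integral_const_mul]
  refine integral_congr_ae (ae_of_all _ fun x => ?_)
  simp only [pseudoDiff_modTest]
  have e (η : Space d) : Complex.exp (-(Complex.I * ((-k * inner ℝ θ x : ℝ) : ℂ))) *
      Complex.exp (Complex.I * ((inner ℝ x (η - (k + τ) • θ) : ℝ) : ℂ)) =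
      Complex.exp (-(Complex.I * ((inner ℝ x (τ • θ) : ℝ) : ℂ))) *
        Complex.exp (Complex.I * ((inner ℝ x η : ℝ) : ℂ)) := by
    rw [← Complex.exp_add, ← Complex.exp_add, inner_sub_right, inner_smul_right,
      inner_smul_right, real_inner_comm θ x]
    congr 1
    push_cast
    ring
  have inner_eq : ((k ^ m : ℝ) : ℂ) * modTest c θ (-k) x * ∫ η, Complex.exp (Complex.I *
      ((inner ℝ x (η - (k + τ) • θ) : ℝ) : ℂ)) * σ x (η - (k + τ) • θ) * hat χ η =
      c x * Complex.exp (-(Complex.I * ((inner ℝ x (τ • θ) : ℝ) : ℂ))) *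
        ∫ η, diagIntegrand σ m θ τ χ k x η := by
    rw [← integral_const_mul, ← integral_const_mul]
    refine integral_congr_ae (ae_of_all _ fun η => ?_)
    have e := e η
    simp only [modTest_apply, diagIntegrand]
    linear_combination (((k ^ m : ℝ) : ℂ) * c x * σ x (η - (k + τ) • θ) * hat χ η) * e
  linear_combination ((((2 * Real.pi) ^ d)⁻¹ : ℝ) : ℂ) * inner_eq

/-- If `c χ = 1` on the support of the strength `μ`, then the form at frequencies `k` and `k + τ`
is asymptotic to `k^{-m} μ̂(τθ)`. -/
theorem tendsto_modForm {σ : Space d → Space d → ℂ} {m : ℝ} {μ : Space d → ℝ}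
    (hσ : IsClassicalSymbol (-m) σ (fun x ξ => ((μ x * ‖ξ‖ ^ (-m) : ℝ) : ℂ)))
    {θ : Space d} (hθ : ‖θ‖ = 1) {τ : ℝ} (hτ : 0 ≤ τ) (c χ : Test d)
    (hcχ : ∀ x, μ x ≠ 0 → c x * χ x = 1) :
    Tendsto (fun k : ℝ => ((k ^ m : ℝ) : ℂ) * modForm σ θ c χ k (k + τ)) atTop
      (𝓝 (hat (fun x => (μ x : ℂ)) (τ • θ))) := by
  obtain ⟨C, hC⟩ := exists_norm_diagIntegrand_le hσ.1 hθ hτ χ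
  have hpn (x : Space d) :
      ‖Complex.exp (-(Complex.I * ((inner ℝ x (τ • θ) : ℝ) : ℂ)))‖ = 1 := by
    rw [← mul_neg, ← Complex.ofReal_neg]
    exact Complex.norm_exp_I_mul_ofReal _
  have hlimit : hat (fun x => (μ x : ℂ)) (τ • θ) =
      ∫ x, c x * Complex.exp (-(Complex.I * ((inner ℝ x (τ • θ) : ℝ) : ℂ))) * (μ x * χ x) := by
    rw [hat]
    refine integral_congr_ae (ae_of_all _ fun x => ?_)
    by_cases hx : μ x = 0
    · simp [hx]
    · linear_combination
        (-(Complex.exp (-(Complex.I * ((inner ℝ x (τ • θ) : ℝ) : ℂ))) * μ x)) * hcχ x hx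
  simp_rw [rpow_mul_modForm_eq]
  rw [hlimit]
  have hci : Integrable fun x => ‖c x‖ :=
    (c.continuous.integrable_of_hasCompactSupport c.hasCompactSupport).norm
  refine tendsto_integral_filter_of_dominated_convergence (fun x => ‖c x‖ *
      (‖((((2 * Real.pi) ^ d)⁻¹ : ℝ) : ℂ)‖ * ∫ η, C * ((1 + ‖η‖) ^ |m| * ‖hat χ η‖)))
    (Eventually.of_forall fun k => ?_) ?_ (hci.mul_const _) (ae_of_all _ fun x => ?_)
  · have h1 : StronglyMeasurable fun x => ∫ η, diagIntegrand σ m θ τ χ k x η :=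
      StronglyMeasurable.integral_prod_right (f := fun x η => diagIntegrand σ m θ τ χ k x η)
        (continuous_diagIntegrand hσ.1 m θ τ χ k).stronglyMeasurable
    have h2 : Continuous fun x =>
        c x * Complex.exp (-(Complex.I * ((inner ℝ x (τ • θ) : ℝ) : ℂ))) :=
      c.continuous.mul (Complex.continuous_exp.comp (continuous_const.mul
        (Complex.continuous_ofReal.comp (continuous_id.inner continuous_const))).neg)
    exact (h2.stronglyMeasurable.mul (h1.const_mul _)).aestronglyMeasurable
  · filter_upwards [eventually_ge_atTop 1] with k hk
    refine ae_of_all _ fun x => ?_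
    rw [norm_mul, norm_mul, hpn, mul_one, norm_mul]
    refine mul_le_mul_of_nonneg_left ?_ (norm_nonneg _)
    refine mul_le_mul_of_nonneg_left ?_ (norm_nonneg _)
    exact norm_integral_le_of_norm_le ((integrable_rpow_mul_norm_hat χ |m|).const_mul C)
      (ae_of_all _ (hC k hk x))
  · exact (tendsto_integral_diagIntegrand hσ hθ hτ χ x).const_mul _

end Asymptotics

/-! ### Averages of products of Gaussian processes -/

section Average

variable {Ω : Type*} [MeasurableSpace Ω] {P : Measure Ω}

/-- By Wick's formula the centered product `U_k V_k - 𝔼(U_k V_k)` decorrelates as soon as the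
second moments of `U` and `V` do; hence the averages of the product converge to the limit of
its expectation. -/
theorem ae_tendsto_average_mul [IsProbabilityMeasure P] {G : Submodule ℝ (Ω → ℝ)}
    (hG : IsGaussianSpace P G) {U V : ℝ → Ω → ℂ} (hU : ∀ k, MemComplexify G (U k))
    (hV : ∀ k, MemComplexify G (V k)) (hUc : ∀ w, Continuous fun k => U k w)
    (hVc : ∀ w, Continuous fun k => V k w) {r : ℝ → ℝ} (hr : ContinuousOn r (Set.Ici 1))
    {m A M : ℝ} (hrA : ∀ k, 1 ≤ k → |r k| ≤ A * k ^ m)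
    (hUV : ∀ k l : ℝ, 1 ≤ k → 1 ≤ l → k ≤ 2 * l → l ≤ 2 * k →
      ‖∫ w, U k w * conj (U l w) ∂P‖ ≤ M * k ^ (-m) * (1 + |k - l|)⁻¹ ∧
      ‖∫ w, V k w * conj (V l w) ∂P‖ ≤ M * k ^ (-m) * (1 + |k - l|)⁻¹ ∧
      ‖∫ w, U k w * conj (V l w) ∂P‖ ≤ M * k ^ (-m) * (1 + |k - l|)⁻¹ ∧
      ‖∫ w, V k w * conj (U l w) ∂P‖ ≤ M * k ^ (-m) * (1 + |k - l|)⁻¹)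
    {L : ℂ} (hL : Tendsto (fun k => (r k : ℂ) * ∫ w, U k w * V k w ∂P) atTop (𝓝 L)) :
    ∀ᵐ w ∂P, Tendsto (fun K : ℝ => ((K : ℂ))⁻¹ * ∫ k in K..(2 * K), (r k : ℂ) * (U k w * V k w))
      atTop (𝓝 L) := by
  have mU (k : ℝ) := (hU k).hasMoments hG
  have mV (k : ℝ) := (hV k).hasMoments hG
  have mY (k : ℝ) := (mU k).mul (mV k)
  have hYc (w : Ω) : Continuous fun k => U k w * V k w := (hUc w).mul (hVc w)
  obtain ⟨Y, hYm, hY⟩ := exists_stronglyMeasurable_modification hYc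
    (fun k => (mY k).integrable.aemeasurable)
  have hYk (k : ℝ) : Y k =ᵐ[P] fun w => U k w * V k w := hY.mono fun w hw => hw k
  have mY' (k : ℝ) : HasMoments P (Y k) := fun n => (mY k n).ae_eq (hYk k).symm
  set e : ℝ → ℂ := fun k => ∫ w, U k w * V k w ∂P with he
  have heY (k : ℝ) : e k = ∫ w, Y k w ∂P := (integral_congr_ae (hYk k)).symm
  have hem : StronglyMeasurable e := by
    have : e = fun k => ∫ w, Y k w ∂P := funext heY
    rw [this]
    exact StronglyMeasurable.integral_prod_right hYm
  have hA0 : 0 ≤ A := by simpa using (abs_nonneg _).trans (hrA 1 le_rfl)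
  have hM0 : 0 ≤ M := by
    simpa using (norm_nonneg _).trans (hUV 1 1 le_rfl le_rfl (by norm_num) (by norm_num)).1
  -- The weight is continued by a constant to the left of `1`.
  set ρ : ℝ → ℝ := fun k => r (max 1 k) with hρ
  have hρc : Continuous ρ := hr.comp_continuous (by fun_prop) fun k => Set.mem_Ici.2 (le_max_left _ _)
  have hρr (k : ℝ) (hk : 1 ≤ k) : ρ k = r k := by simp [hρ, hk]
  -- The weighted expectation is bounded, by the Cauchy–Schwarz inequality.
  have hsq {U : ℝ → Ω → ℂ} (k : ℝ) (hb : ‖∫ w, U k w * conj (U k w) ∂P‖ ≤ M * k ^ (-m)) :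
      ∫ w, ‖U k w‖ ^ 2 ∂P ≤ M * k ^ (-m) := by
    have e1 : ∫ w, U k w * conj (U k w) ∂P = ((∫ w, ‖U k w‖ ^ 2 ∂P : ℝ) : ℂ) := by
      rw [← integral_complex_ofReal]
      refine integral_congr_ae (ae_of_all _ fun w => ?_)
      simp only [Complex.mul_conj, Complex.normSq_eq_norm_sq]
    rw [e1, Complex.norm_real] at hb
    exact (le_abs_self _).trans hb
  have hpow (k : ℝ) (hk : 1 ≤ k) : k ^ m * k ^ (-m) = 1 := by
    rw [← Real.rpow_add (by linarith), add_neg_cancel, Real.rpow_zero]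
  have hreb (k : ℝ) (hk : 1 ≤ k) : ‖(ρ k : ℂ) * e k‖ ≤ A * M := by
    have h := hUV k k hk hk (by linarith) (by linarith)
    simp only [sub_self, abs_zero, add_zero, inv_one, mul_one] at h
    have i1 : Integrable (fun w => ‖U k w‖ ^ 2) P :=
      (memLp_two_iff_integrable_sq_norm (mU k 2).1).1 (mU k 2)
    have i2 : Integrable (fun w => ‖V k w‖ ^ 2) P :=
      (memLp_two_iff_integrable_sq_norm (mV k 2).1).1 (mV k 2)
    have he1 : ‖e k‖ ≤ M * k ^ (-m) := by
      calc ‖e k‖ ≤ ∫ w, (‖U k w‖ ^ 2 + ‖V k w‖ ^ 2) / 2 ∂P := by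
            refine norm_integral_le_of_norm_le ((i1.add i2).div_const 2) (ae_of_all _ fun w => ?_)
            simp only [norm_mul]
            nlinarith [sq_nonneg (‖U k w‖ - ‖V k w‖)]
        _ = ((∫ w, ‖U k w‖ ^ 2 ∂P) + ∫ w, ‖V k w‖ ^ 2 ∂P) / 2 := by
            rw [integral_div, integral_add i1 i2]
        _ ≤ M * k ^ (-m) := by linarith [hsq k h.1, hsq (U := V) k h.2.1]
    rw [norm_mul, Complex.norm_real, Real.norm_eq_abs, hρr k hk]
    calc |r k| * ‖e k‖ ≤ (A * k ^ m) * (M * k ^ (-m)) := by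
          have : 0 ≤ k := by linarith
          gcongr
          exact hrA k hk
      _ = A * M * (k ^ m * k ^ (-m)) := by ring
      _ = A * M := by rw [hpow k hk, mul_one]
  have hrei (a b : ℝ) (ha : 1 ≤ a) (hab : a ≤ b) :
      IntervalIntegrable (fun k => (ρ k : ℂ) * e k) volume a b := by
    rw [intervalIntegrable_iff_integrableOn_Ioc_of_le hab]
    refine Measure.integrableOn_of_bounded (M := A * M) (by simp) ?_ ?_
    · exact ((Complex.continuous_ofReal.comp hρc).stronglyMeasurable.mul hem).aestronglyMeasurable
    · filter_upwards [ae_restrict_mem measurableSet_Ioc] with k hk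
      exact hreb k (by linarith [hk.1])
  set Z : ℝ → Ω → ℂ := fun k w => (ρ k : ℂ) * (Y k w - e k) with hZdef
  have hZm : StronglyMeasurable (Function.uncurry Z) := by
    have h1 : StronglyMeasurable fun p : ℝ × Ω => (ρ p.1 : ℂ) :=
      (Complex.continuous_ofReal.comp hρc).stronglyMeasurable.comp_measurable measurable_fst
    exact h1.mul (hYm.sub (hem.comp_measurable measurable_fst))
  have hYi (w : Ω) (a b : ℝ) :
      IntervalIntegrable (fun k => (ρ k : ℂ) * (U k w * V k w)) volume a b :=
    ((Complex.continuous_ofReal.comp hρc).mul (hYc w)).intervalIntegrable a b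
  have hmain := ae_tendsto_average_zero (P := P) (Z := Z) hZm (by
      filter_upwards [hY] with w hw a b ha hab
      refine ((hYi w a b).sub (hrei a b ha hab)).congr (fun k _ => ?_)
      simp only [hZdef, hw k]
      ring) (fun k hk => by
      have hm : MemLp (fun w => Y k w - e k) 2 P := by
        exact_mod_cast ((mY' k) 2).sub (memLp_const (e k))
      have hm2 : MemLp (Z k) 2 P := hm.const_mul _
      exact (memLp_two_iff_integrable_sq_norm hm2.1).1 hm2)
    (M := A ^ 2 * 2 ^ |m| * (2 * M ^ 2)) (fun k l hk hl hkl hlk => by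
      have hk0 : 0 < k := by linarith
      have hl0 : 0 < l := by linarith
      have hcov : ∫ w, Z k w * conj (Z l w) ∂P = (ρ k : ℂ) * (ρ l : ℂ) *
          ((∫ w, U k w * conj (U l w) ∂P) * (∫ w, V k w * conj (V l w) ∂P) +
            (∫ w, U k w * conj (V l w) ∂P) * (∫ w, V k w * conj (U l w) ∂P)) := by
        have hw := hG.wick (hU k) (hV k) (hU l).star (hV l).star
        unfold Wick at hw
        beta_reduce at hw
        have c1 : ∫ w, conj (U l w) * conj (V l w) ∂P = conj (e l) := by
          rw [he, ← integral_conj]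
          simp only [map_mul]
        have i1 : Integrable (fun w => U k w * V k w * (conj (U l w) * conj (V l w))) P :=
          ((mY k).mul ((mU l).star.mul (mV l).star)).integrable
        have i2 : Integrable (fun w => conj (e l) * (U k w * V k w)) P :=
          (mY k).integrable.const_mul _
        have i3 : Integrable (fun w => e k * (conj (U l w) * conj (V l w))) P :=
          ((mU l).star.mul (mV l).star).integrable.const_mul _
        have e1 : ∫ w, Z k w * conj (Z l w) ∂P = ∫ w, (ρ k : ℂ) * (ρ l : ℂ) *
            (U k w * V k w * (conj (U l w) * conj (V l w)) - conj (e l) * (U k w * V k w) -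
              e k * (conj (U l w) * conj (V l w)) + e k * conj (e l)) ∂P := by
          refine integral_congr_ae ?_
          filter_upwards [hYk k, hYk l] with w h1 h2
          simp only [hZdef, h1, h2, map_mul, map_sub, Complex.conj_ofReal]
          ring
        rw [e1, integral_const_mul, integral_add (by fun_prop) (integrable_const _),
          integral_sub (by fun_prop) i3, integral_sub i1 i2, integral_const_mul, integral_const_mul,
          hw, c1]
        simp only [integral_const, probReal_univ, one_smul]
        rw [he]
        ring
      obtain ⟨b1, b2, b3, b4⟩ := hUV k l hk hl hkl hlk
      set B : ℝ := M * k ^ (-m) * (1 + |k - l|)⁻¹ with hB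
      have hB0 : 0 ≤ B := by positivity
      have hl2 : l ^ m ≤ 2 ^ |m| * k ^ m := by
        have := rpow_neg_le_of_comparable (L := 2) (-m) hl0 hk0 hlk hkl
        rwa [neg_neg, abs_neg] at this
      have hinv : ((1 + |k - l|)⁻¹) ^ 2 ≤ (1 + (k - l) ^ 2)⁻¹ := by
        rw [inv_pow]
        refine inv_anti₀ (by positivity) ?_
        nlinarith [abs_nonneg (k - l), sq_abs (k - l)]
      rw [hcov, norm_mul, norm_mul, Complex.norm_real, Complex.norm_real, Real.norm_eq_abs,
        Real.norm_eq_abs, hρr k hk, hρr l hl]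
      calc _ ≤ (A * k ^ m) * (A * (2 ^ |m| * k ^ m)) * (B * B + B * B) := by
            refine mul_le_mul (mul_le_mul (hrA k hk) ((hrA l hl).trans ?_) (abs_nonneg _)
              (by positivity)) ?_ (norm_nonneg _) (by positivity)
            · exact mul_le_mul_of_nonneg_left hl2 hA0
            · refine (norm_add_le _ _).trans (add_le_add ?_ ?_) <;> rw [norm_mul]
              · exact mul_le_mul b1 b2 (norm_nonneg _) hB0
              · exact mul_le_mul b3 b4 (norm_nonneg _) hB0
        _ = A ^ 2 * 2 ^ |m| * (2 * M ^ 2) * (k ^ m * k ^ (-m)) ^ 2 * ((1 + |k - l|)⁻¹) ^ 2 := by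
            rw [hB]; ring
        _ ≤ _ := by
            rw [hpow k hk, one_pow, mul_one]
            gcongr)
  have hmean := tendsto_average_of_tendsto (e := fun k => (ρ k : ℂ) * e k) (L := L)
    (hL.congr' (by
      filter_upwards [eventually_ge_atTop 1] with k hk
      rw [hρr k hk])) hrei
  filter_upwards [hmain, hY] with w h1 hw
  have h := h1.add hmean
  rw [zero_add] at h
  refine h.congr' ?_
  filter_upwards [eventually_ge_atTop 1] with K hK
  rw [← mul_add]
  congr 1
  have hKK : K ≤ 2 * K := by linarith
  have e3 : ∫ k in K..(2 * K), Z k w =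
      (∫ k in K..(2 * K), (ρ k : ℂ) * (U k w * V k w)) - ∫ k in K..(2 * K), (ρ k : ℂ) * e k := by
    rw [← intervalIntegral.integral_sub (hYi w _ _) (hrei _ _ hK hKK)]
    refine intervalIntegral.integral_congr fun k _ => ?_
    simp only [hZdef, hw k]
    ring
  rw [e3, sub_add_cancel]
  refine intervalIntegral.integral_congr fun k hk => ?_
  rw [Set.uIcc_of_le hKK] at hk
  simp only [hρr k (hK.trans hk.1)]

end Average

/-! ### The random field paired with plane waves -/

section RandomField

variable {Ω : Type*} {d : ℕ}

/-- The real variables `Re ⟨f, φ⟩`, for all test functions `φ`. -/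
def reSpace (f : Ω → Distr d) : Submodule ℝ (Ω → ℝ) where
  carrier := Set.range fun (φ : Test d) w => (f w φ).re
  add_mem' := by
    rintro _ _ ⟨φ, rfl⟩ ⟨ψ, rfl⟩
    exact ⟨φ + ψ, funext fun w => by simp⟩
  zero_mem' := ⟨0, funext fun w => by simp⟩
  smul_mem' := by
    rintro c _ ⟨φ, rfl⟩
    exact ⟨(c : ℂ) • φ, funext fun w => by simp⟩

theorem memComplexify_reSpace (f : Ω → Distr d) (φ : Test d) :
    MemComplexify (reSpace f) (fun w => f w φ) := by
  refine ⟨_, ⟨φ, rfl⟩, _, ⟨-Complex.I • φ, rfl⟩, funext fun w => ?_⟩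
  have h : f w (-Complex.I • φ) = -Complex.I * f w φ := map_smul _ _ _
  beta_reduce
  rw [h]
  apply Complex.ext <;> simp

variable [MeasurableSpace Ω] {P : Measure Ω}

theorem IsGMIG.isGaussianSpace {f : Ω → Distr d} {m : ℝ} {D : Set (Space d)}
    {μc μr : Space d → ℝ} (h : IsGMIG P f m D μc μr) : IsGaussianSpace P (reSpace f) where
  gaussian := by
    rintro _ ⟨φ, rfl⟩
    exact (h.gaussian φ).map_fun Complex.reCLM
  centered := by
    rintro _ ⟨φ, rfl⟩
    have h1 := Complex.reCLM.integral_comp_comm (h.gaussian φ).integrable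
    rw [h.centered φ, map_zero] at h1
    exact h1

theorem conjTest_modTest (χ : Test d) (θ : Space d) (t : ℝ) :
    conjTest (modTest χ θ t) = modTest (conjTest χ) θ (-t) := by
  ext x
  change conj (modTest χ θ t x) = conj (χ x) * _
  rw [modTest_apply, map_mul, ← Complex.exp_conj]
  simp [planeWave]

theorem conjTest_conjTest (φ : Test d) : conjTest (conjTest φ) = φ := by
  ext x
  exact Complex.conj_conj (φ x)

theorem modTest_neg (χ : Test d) (θ : Space d) (t : ℝ) :
    modTest χ (-θ) t = modTest χ θ (-t) := by
  ext x
  rw [modTest_apply, modTest_apply, inner_neg_left]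
  simp

theorem integral_conj_mul_eq_modForm {f : Ω → Distr d} {σ : Space d → Space d → ℂ}
    (hσ : HasSymbol (covarianceForm P f) σ) (χ : Test d) (θ : Space d) (s t : ℝ) :
    ∫ w, conj (f w (modTest χ θ s)) * f w (modTest χ θ t) ∂P =
      modForm σ θ (conjTest χ) χ s t := by
  have h := hσ (conjTest (modTest χ θ s)) (modTest χ θ t)
  rw [covarianceForm, conjTest_conjTest, conjTest_modTest] at h
  exact h

theorem integral_mul_eq_modForm {f : Ω → Distr d} {σ : Space d → Space d → ℂ}
    (hσ : HasSymbol (relationForm P f) σ) (χ : Test d) (θ : Space d) (s t : ℝ) :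
    ∫ w, f w (modTest χ θ s) * f w (modTest χ θ t) ∂P = modForm σ θ χ χ (-s) t := by
  have h := hσ (modTest χ θ s) (modTest χ θ t)
  rw [modForm, neg_neg]
  exact h

/-- Second moments of the field at two frequencies of comparable size: the covariance decays in
the difference of the frequencies, the relation in their sum. -/
theorem IsGMIG.exists_second_moment_le {f : Ω → Distr d} {m : ℝ} {D : Set (Space d)}
    {μc μr : Space d → ℝ} (h : IsGMIG P f m D μc μr) (χ : Test d) {θ : Space d} (hθ : ‖θ‖ = 1) :
    ∃ M, 0 ≤ M ∧ ∀ s t : ℝ,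
      (1 + |s - t|) * ‖∫ w, conj (f w (modTest χ θ s)) * f w (modTest χ θ t) ∂P‖ ≤
        M * (1 + |t|) ^ (-m) ∧
      (1 + |s + t|) * ‖∫ w, f w (modTest χ θ s) * f w (modTest χ θ t) ∂P‖ ≤
        M * (1 + |t|) ^ (-m) := by
  obtain ⟨σ, hσ, hfσ⟩ := h.covariance
  obtain ⟨ρ, hρ, hfρ⟩ := h.relation
  obtain ⟨M, hM0, hM⟩ := exists_modForm_le hσ.1 hθ (conjTest χ) χ
  obtain ⟨N, hN0, hN⟩ := exists_modForm_le hρ.1 hθ χ χ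
  refine ⟨max M N, le_max_of_le_left hM0, fun s t => ⟨?_, ?_⟩⟩
  · rw [integral_conj_mul_eq_modForm hfσ]
    exact (hM s t).trans (mul_le_mul_of_nonneg_right (le_max_left _ _) (by positivity))
  · rw [integral_mul_eq_modForm hfρ]
    have hst : |s + t| = |-s - t| := by rw [← abs_neg]; congr 1; ring
    rw [hst]
    exact (hN (-s) t).trans (mul_le_mul_of_nonneg_right (le_max_right _ _) (by positivity))

/-- The decay of a second moment `N`, restated at frequencies `k`, `l` of comparable size, where `r`
is the difference or the sum of the frequencies shifted by at most `τ`. -/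
theorem le_rpow_of_comparable {m M τ N r t k l : ℝ} (hM : 0 ≤ M) (hτ : 0 ≤ τ) (hk : 1 ≤ k)
    (hN0 : 0 ≤ N) (hN : (1 + |r|) * N ≤ M * (1 + |t|) ^ (-m)) (hr : |k - l| ≤ τ + |r|)
    (ht : |t| ≤ 2 * k + τ) (ht' : k ≤ 2 * |t|) :
    N ≤ (1 + τ) * (M * (3 + τ) ^ |m|) * k ^ (-m) * (1 + |k - l|)⁻¹ := by
  have h1 := rpow_neg_le_of_comparable (a := 1 + |t|) (b := k) (L := 3 + τ) m (by positivity)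
    (by linarith) (by nlinarith) (by nlinarith [abs_nonneg t])
  have h2 : 1 + |k - l| ≤ (1 + τ) * (1 + |r|) := by nlinarith [abs_nonneg r]
  rw [← div_eq_mul_inv, le_div_iff₀ (by positivity)]
  calc N * (1 + |k - l|) ≤ N * ((1 + τ) * (1 + |r|)) := by gcongr
    _ = (1 + τ) * ((1 + |r|) * N) := by ring
    _ ≤ (1 + τ) * (M * ((3 + τ) ^ |m| * k ^ (-m))) := by
        refine mul_le_mul_of_nonneg_left ?_ (by linarith)
        exact hN.trans (mul_le_mul_of_nonneg_left h1 hM)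
    _ = _ := by ring

theorem norm_integral_mul_conj_eq (U V : Ω → ℂ) :
    ‖∫ w, U w * conj (V w) ∂P‖ = ‖∫ w, conj (V w) * U w ∂P‖ := by
  simp_rw [mul_comm]

theorem norm_integral_conj_mul_conj_eq (U V : Ω → ℂ) :
    ‖∫ w, conj (U w) * conj (V w) ∂P‖ = ‖∫ w, U w * V w ∂P‖ := by
  rw [← RCLike.norm_conj, ← integral_conj]
  simp

/-! ### Frequency weights -/

theorem rpow_mul_rpow_eq {m β τ k : ℝ} (hτ : 0 ≤ τ) (hk : 1 ≤ k) :
    k ^ (m - β) * (k + τ) ^ β = k ^ m * ((k + τ) / k) ^ β := by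
  have hk0 : 0 < k := by linarith
  rw [Real.div_rpow (by linarith) hk0.le, Real.rpow_sub hk0]
  ring

theorem tendsto_add_div_rpow (β τ : ℝ) :
    Tendsto (fun k : ℝ => ((k + τ) / k) ^ β) atTop (𝓝 1) := by
  have h : Tendsto (fun k : ℝ => (k + τ) / k) atTop (𝓝 1) := by
    have h1 : Tendsto (fun k : ℝ => 1 + τ * k⁻¹) atTop (𝓝 (1 + τ * 0)) :=
      (tendsto_inv_atTop_zero.const_mul τ).const_add 1
    rw [mul_zero, add_zero] at h1
    refine h1.congr' ?_
    filter_upwards [eventually_gt_atTop 0] with k hk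
    field_simp
  simpa using h.rpow_const (p := β) (Or.inl one_ne_zero)

theorem abs_rpow_mul_rpow_le {m β τ k : ℝ} (hτ : 0 ≤ τ) (hk : 1 ≤ k) :
    |k ^ (m - β) * (k + τ) ^ β| ≤ (1 + τ) ^ |β| * k ^ m := by
  have hk0 : 0 < k := by linarith
  have hkτ : 0 < k + τ := by linarith
  rw [abs_of_nonneg (by positivity), Real.rpow_sub hk0]
  have h := rpow_neg_le_of_comparable (a := k + τ) (b := k) (L := 1 + τ) (-β) hkτ hk0
    (by nlinarith) (by nlinarith)
  rw [neg_neg, abs_neg] at h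
  calc k ^ m / k ^ β * (k + τ) ^ β ≤ k ^ m / k ^ β * ((1 + τ) ^ |β| * k ^ β) := by gcongr
    _ = _ := by field_simp

theorem continuousOn_rpow_mul_rpow (m β : ℝ) {τ : ℝ} (hτ : 0 ≤ τ) :
    ContinuousOn (fun k : ℝ => k ^ (m - β) * (k + τ) ^ β) (Set.Ici 1) := by
  refine ContinuousOn.mul ?_ ?_
  · exact continuousOn_id.rpow_const fun k hk => Or.inl (by
      have : (1 : ℝ) ≤ k := hk
      simp only [id]
      linarith)
  · exact (by fun_prop : ContinuousOn (fun k : ℝ => k + τ) _).rpow_const fun k hk => Or.inl (by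
      have : (1 : ℝ) ≤ k := hk
      linarith)

/-- The exponent of `k` in the far-field constant, for `d = 1, 2, 3`. -/
noncomputable def farExponent (d : ℕ) (α : ℝ) : ℝ := ((d : ℝ) + 1) / 2 - 2 * α

theorem covConst_mul_farConst {d : ℕ} (hd : d = 1 ∨ d = 2 ∨ d = 3) {α : ℝ} (hα : α ≠ 0)
    (k l : ℝ) : covConst d α * (conj (farConst d α k) * farConst d α l) =
      ((k ^ farExponent d α * l ^ farExponent d α : ℝ) : ℂ) := by
  have hα' : (α : ℂ) ≠ 0 := by exact_mod_cast hα
  have hπ : (Real.pi : ℂ) ≠ 0 := by exact_mod_cast Real.pi_ne_zero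
  have hs : ((Real.sqrt Real.pi : ℝ) : ℂ) ^ 2 = Real.pi := by
    rw [← Complex.ofReal_pow, Real.sq_sqrt Real.pi_nonneg]
  have hs0 : ((Real.sqrt Real.pi : ℝ) : ℂ) ≠ 0 := by
    intro h; rw [h] at hs; exact hπ (by rw [← hs]; norm_num)
  rcases hd with rfl | rfl | rfl
  · have e : farExponent 1 α = 1 - 2 * α := by norm_num [farExponent]
    rw [e]
    simp only [covConst, farConst, if_true, map_div₀, map_mul, Complex.conj_I, Complex.conj_ofReal,
      map_ofNat, Complex.ofReal_mul]
    field_simp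
    rw [Complex.I_sq]
    ring
  · have e : farExponent 2 α = 3 / 2 - 2 * α := by norm_num [farExponent]
    rw [e]
    simp only [covConst, farConst, if_true, map_div₀, map_mul, map_add, map_one, Complex.conj_I,
      Complex.conj_ofReal, map_ofNat, Complex.ofReal_mul, OfNat.ofNat_ne_one, if_false]
    generalize ((k ^ (3 / 2 - 2 * α) : ℝ) : ℂ) = a
    generalize ((l ^ (3 / 2 - 2 * α) : ℝ) : ℂ) = b
    field_simp
    rw [hs]
    linear_combination (-8 * (Real.pi : ℂ) * a * b) * Complex.I_sq
  · have e : farExponent 3 α = 2 - 2 * α := by norm_num [farExponent]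
    rw [e]
    simp only [covConst, farConst, map_div₀, map_mul, Complex.conj_ofReal,
      map_ofNat, Complex.ofReal_mul, OfNat.ofNat_ne_one, if_false,
      show (3 : ℕ) ≠ 2 by norm_num]
    field_simp
    ring

theorem relConst_mul_farConst {d : ℕ} (hd : d = 1 ∨ d = 2 ∨ d = 3) {α : ℝ} (hα : α ≠ 0)
    (k l : ℝ) : relConst d α * (farConst d α k * farConst d α l) =
      ((k ^ farExponent d α * l ^ farExponent d α : ℝ) : ℂ) := by
  have hα' : (α : ℂ) ≠ 0 := by exact_mod_cast hα
  have hπ : (Real.pi : ℂ) ≠ 0 := by exact_mod_cast Real.pi_ne_zero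
  have hs : ((Real.sqrt Real.pi : ℝ) : ℂ) ^ 2 = Real.pi := by
    rw [← Complex.ofReal_pow, Real.sq_sqrt Real.pi_nonneg]
  have hs0 : ((Real.sqrt Real.pi : ℝ) : ℂ) ≠ 0 := by
    intro h; rw [h] at hs; exact hπ (by rw [← hs]; norm_num)
  rcases hd with rfl | rfl | rfl
  · have e : farExponent 1 α = 1 - 2 * α := by norm_num [farExponent]
    rw [e]
    simp only [relConst, farConst, if_true, Complex.ofReal_mul]
    field_simp
    rw [Complex.I_sq]
    ring
  · have e : farExponent 2 α = 3 / 2 - 2 * α := by norm_num [farExponent]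
    rw [e]
    simp only [relConst, farConst, if_true, Complex.ofReal_mul, OfNat.ofNat_ne_one, if_false]
    generalize ((k ^ (3 / 2 - 2 * α) : ℝ) : ℂ) = a
    generalize ((l ^ (3 / 2 - 2 * α) : ℝ) : ℂ) = b
    field_simp
    rw [hs]
    linear_combination (-8 * (Real.pi : ℂ) * a * b * (Complex.I + 2)) * Complex.I_sq
  · have e : farExponent 3 α = 2 - 2 * α := by norm_num [farExponent]
    rw [e]
    simp only [relConst, farConst, Complex.ofReal_mul, OfNat.ofNat_ne_one, if_false,
      show (3 : ℕ) ≠ 2 by norm_num]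
    field_simp
    ring

/-- For `k > 0` the weight in the average and the two far-field constants combine to
`k^{m - β} (k + τ)^β`, where `β` is the exponent of the far-field constant. -/
theorem weight_eq {d : ℕ} (α m : ℝ) {k τ : ℝ} (hk : 0 < k) :
    k ^ (m + 4 * α - (d : ℝ) - 1) * (k ^ farExponent d α * (k + τ) ^ farExponent d α) =
      k ^ (m - farExponent d α) * (k + τ) ^ farExponent d α := by
  rw [← mul_assoc, ← Real.rpow_add hk]
  congr 2
  rw [farExponent]
  ring

/-- The averages in terms of `g k = U_k V_k`, once the far-field constants are absorbed. -/
theorem average_eq {d : ℕ} {α m τ : ℝ} {κ : ℂ} {C C' : ℝ → ℂ}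
    (hκ : ∀ k, κ * (C k * C' (k + τ)) = ((k ^ farExponent d α * (k + τ) ^ farExponent d α : ℝ) : ℂ))
    (U V : ℝ → ℂ) {K : ℝ} (hK : 1 ≤ K) :
    κ / (K : ℂ) * ∫ k in K..(2 * K), ((k ^ (m + 4 * α - (d : ℝ) - 1) : ℝ) : ℂ) *
        (C k * U k * (C' (k + τ) * V (k + τ))) =
      ((K : ℂ))⁻¹ * ∫ k in K..(2 * K),
        ((k ^ (m - farExponent d α) * (k + τ) ^ farExponent d α : ℝ) : ℂ) *
          (U k * V (k + τ)) := by
  rw [div_eq_inv_mul, mul_assoc, ← intervalIntegral.integral_const_mul]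
  congr 1
  refine intervalIntegral.integral_congr fun k hk => ?_
  rw [Set.uIcc_of_le (by linarith)] at hk
  rw [← weight_eq (d := d) α m (show 0 < k by linarith [hk.1]), Complex.ofReal_mul, ← hκ k]
  ring

end RandomField

end RandomSource

theorem mainTheorem2 {Ω : Type*} [MeasurableSpace Ω] (P : Measure Ω) [IsProbabilityMeasure P]
    (d : ℕ) (hd : d = 1 ∨ d = 2 ∨ d = 3) (α m : ℝ) (D : Set (Space d)) (μc μr : Space d → ℝ)
    (f : Ω → Distr d) (hf : SourceAssumption P f α m D μc μr)
    (θ : Space d) (hθ : ‖θ‖ = 1) (τ : ℝ) (hτ : 0 ≤ τ) :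
    ∀ᵐ ω ∂P,
      Tendsto
        (fun K : ℝ => covConst d α / (K : ℂ) * ∫ k in K..(2 * K),
          ((k ^ (m + 4 * α - (d : ℝ) - 1) : ℝ) : ℂ) *
            (conj (born α D (f ω) θ k) * born α D (f ω) θ (k + τ)))
        atTop (𝓝 (hat (fun x => (μc x : ℂ)) (τ • θ))) ∧
      Tendsto
        (fun K : ℝ => relConst d α / (K : ℂ) * ∫ k in K..(2 * K),
          ((k ^ (m + 4 * α - (d : ℝ) - 1) : ℝ) : ℂ) *
            (born α D (f ω) (-θ) k * born α D (f ω) θ (k + τ)))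
        atTop (𝓝 (hat (fun x => (μr x : ℂ)) (τ • θ))) := by
  have hα : α ≠ 0 := by
    have h := hf.alpha_mem.1
    unfold alphaBound at h
    split_ifs at h <;> linarith
  set χ : Test d := cutoff D
  have hg := hf.gmig
  have hG := hg.isGaussianSpace
  -- The cutoff is `1` on `D`, hence on the support of the strengths.
  have hχ1 {μ : Space d → ℝ} (hμ : IsStrength D μ) (x : Space d) (hx : μ x ≠ 0) : χ x = 1 := by
    have hxD : x ∈ closure D := subset_closure (hμ.support_subset (subset_tsupport _ hx))
    exact ((isCutoff_cutoff hf.bounded).filter_mono (nhds_le_nhdsSet hxD)).self_of_nhds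
  let X : ℝ → Ω → ℂ := fun t w => f w (modTest χ θ t)
  have hX (t : ℝ) : MemComplexify (reSpace f) (X t) := memComplexify_reSpace f _
  have hXc (w : Ω) : Continuous fun t => X t w :=
    (f w).continuous.comp (continuous_mulTest_planeWave χ θ)
  obtain ⟨M, hM0, hM⟩ := hg.exists_second_moment_le χ hθ
  have hC (s t : ℝ) : (1 + |s - t|) * ‖∫ w, conj (X s w) * X t w ∂P‖ ≤ M * (1 + |t|) ^ (-m) :=
    (hM s t).1
  have hR (s t : ℝ) : (1 + |s + t|) * ‖∫ w, X s w * X t w ∂P‖ ≤ M * (1 + |t|) ^ (-m) := (hM s t).2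
  set β := farExponent d α
  have hlim {E : ℝ → ℂ} {L : ℂ} (h : Tendsto (fun k => ((k ^ m : ℝ) : ℂ) * E k) atTop (𝓝 L)) :
      Tendsto (fun k => ((k ^ (m - β) * (k + τ) ^ β : ℝ) : ℂ) * E k) atTop (𝓝 L) := by
    have h1 := h.mul ((Complex.continuous_ofReal.tendsto _).comp (tendsto_add_div_rpow β τ))
    rw [Complex.ofReal_one, mul_one] at h1
    refine h1.congr' ?_
    filter_upwards [eventually_ge_atTop 1] with k hk
    rw [rpow_mul_rpow_eq hτ hk]
    simp only [Function.comp_apply, Complex.ofReal_mul]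
    ring
  -- The covariance average: `U_k = conj X_k` and `V_k = X_{k + τ}`.
  have hcov := ae_tendsto_average_mul hG (U := fun k w => conj (X k w))
    (V := fun k => X (k + τ)) (fun k => (hX k).star) (fun k => hX _)
    (fun w => Complex.continuous_conj.comp (hXc w))
    (fun w => (hXc w).comp (by fun_prop : Continuous fun k : ℝ => k + τ))
    (continuousOn_rpow_mul_rpow m β hτ) (m := m) (fun k hk => abs_rpow_mul_rpow_le hτ hk)
    (M := (1 + τ) * (M * (3 + τ) ^ |m|)) (L := hat (fun x => (μc x : ℂ)) (τ • θ))
    (fun k l hk hl hkl hlk => by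
      refine ⟨?_, ?_, ?_, ?_⟩
      · simp only [Complex.conj_conj]
        refine le_rpow_of_comparable hM0 hτ hk (norm_nonneg _) (hC k l) ?_ ?_ ?_
        · linarith
        · rw [abs_of_nonneg (by linarith)]; linarith
        · rw [abs_of_nonneg (by linarith)]; linarith
      · rw [norm_integral_mul_conj_eq]
        refine le_rpow_of_comparable hM0 hτ hk (norm_nonneg _) (hC (l + τ) (k + τ)) ?_ ?_ ?_
        · rw [add_sub_add_right_eq_sub, abs_sub_comm l k]; linarith
        · rw [abs_of_nonneg (by linarith)]; linarith
        · rw [abs_of_nonneg (by linarith)]; linarith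
      · rw [norm_integral_conj_mul_conj_eq]
        refine le_rpow_of_comparable hM0 hτ hk (norm_nonneg _) (hR k (l + τ)) ?_ ?_ ?_
        · rw [abs_of_nonneg (show 0 ≤ k + (l + τ) by linarith)]
          exact abs_le.2 ⟨by linarith, by linarith⟩
        · rw [abs_of_nonneg (by linarith)]; linarith
        · rw [abs_of_nonneg (by linarith)]; linarith
      · simp only [Complex.conj_conj]
        refine le_rpow_of_comparable hM0 hτ hk (norm_nonneg _) (hR (k + τ) l) ?_ ?_ ?_
        · rw [abs_of_nonneg (show 0 ≤ k + τ + l by linarith)]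
          exact abs_le.2 ⟨by linarith, by linarith⟩
        · rw [abs_of_nonneg (by linarith)]; linarith
        · rw [abs_of_nonneg (by linarith)]; linarith)
    (by
      refine hlim ?_
      obtain ⟨σ, hσ, hfσ⟩ := hg.covariance
      simp only [X]
      simp_rw [integral_conj_mul_eq_modForm hfσ]
      refine tendsto_modForm hσ hθ hτ _ _ fun x hx => ?_
      change conj (χ x) * χ x = 1
      rw [hχ1 hg.strength_c x hx, map_one, mul_one])
  -- The relation average: `U_k = X_{-k}` and `V_k = X_{k + τ}`.
  have hrel := ae_tendsto_average_mul hG (U := fun k => X (-k))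
    (V := fun k => X (k + τ)) (fun k => hX _) (fun k => hX _)
    (fun w => (hXc w).comp continuous_neg)
    (fun w => (hXc w).comp (by fun_prop : Continuous fun k : ℝ => k + τ))
    (continuousOn_rpow_mul_rpow m β hτ) (m := m) (fun k hk => abs_rpow_mul_rpow_le hτ hk)
    (M := (1 + τ) * (M * (3 + τ) ^ |m|)) (L := hat (fun x => (μr x : ℂ)) (τ • θ))
    (fun k l hk hl hkl hlk => by
      refine ⟨?_, ?_, ?_, ?_⟩ <;> rw [norm_integral_mul_conj_eq]
      · refine le_rpow_of_comparable hM0 hτ hk (norm_nonneg _) (hC (-l) (-k)) ?_ ?_ ?_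
        · rw [show -l - -k = k - l by ring]; linarith
        · rw [abs_neg, abs_of_nonneg (by linarith)]; linarith
        · rw [abs_neg, abs_of_nonneg (by linarith)]; linarith
      · refine le_rpow_of_comparable hM0 hτ hk (norm_nonneg _) (hC (l + τ) (k + τ)) ?_ ?_ ?_
        · rw [add_sub_add_right_eq_sub, abs_sub_comm l k]; linarith
        · rw [abs_of_nonneg (by linarith)]; linarith
        · rw [abs_of_nonneg (by linarith)]; linarith
      · refine le_rpow_of_comparable hM0 hτ hk (norm_nonneg _) (hC (l + τ) (-k)) ?_ ?_ ?_
        · rw [abs_of_nonneg (show 0 ≤ l + τ - -k by linarith)]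
          exact abs_le.2 ⟨by linarith, by linarith⟩
        · rw [abs_neg, abs_of_nonneg (by linarith)]; linarith
        · rw [abs_neg, abs_of_nonneg (by linarith)]; linarith
      · refine le_rpow_of_comparable hM0 hτ hk (norm_nonneg _) (hC (-l) (k + τ)) ?_ ?_ ?_
        · rw [abs_of_nonpos (show -l - (k + τ) ≤ 0 by linarith)]
          exact abs_le.2 ⟨by linarith, by linarith⟩
        · rw [abs_of_nonneg (by linarith)]; linarith
        · rw [abs_of_nonneg (by linarith)]; linarith)
    (by
      refine hlim ?_
      obtain ⟨σ, hσ, hfσ⟩ := hg.relation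
      simp only [X]
      simp_rw [integral_mul_eq_modForm hfσ, neg_neg]
      refine tendsto_modForm hσ hθ hτ _ _ fun x hx => ?_
      rw [hχ1 hg.strength_r x hx, mul_one])
  filter_upwards [hcov, hrel] with ω hc hr
  constructor
  · refine hc.congr' ?_
    filter_upwards [eventually_ge_atTop 1] with K hK
    rw [← average_eq (d := d) (α := α) (κ := covConst d α) (C := fun k => conj (farConst d α k))
      (C' := farConst d α) (fun k => covConst_mul_farConst hd hα k (k + τ))
      (fun k => conj (X k ω)) (fun k => X k ω) hK]
    simp only [born, map_mul]
    rfl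
  · refine hr.congr' ?_
    filter_upwards [eventually_ge_atTop 1] with K hK
    have hneg (k : ℝ) : pairOn D (f ω) (planeWave (-θ) k) (contDiff_planeWave (-θ) k) =
        X (-k) ω := congrArg (f ω) (modTest_neg χ θ k)
    rw [← average_eq (d := d) (α := α) (κ := relConst d α) (C := farConst d α)
      (C' := farConst d α) (fun k => relConst_mul_farConst hd hα k (k + τ))
      (fun k => X (-k) ω) (fun k => X k ω) hK]
    simp only [born, hneg]
    rfl
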